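/- Let $2^\omega$ be Cantor space. A function $f:2^\omega\to\mathbb R$ is Baire 1 if it is a pointwise limit of a sequence of continuous functions. For $y\in\mathbb R$, $p\in\mathbb Q$ and rational $\varepsilon>0$, the answer "yes" to "$y\lesssim_\varepsilon p$?" is correct if $y<p+\varepsilon$, and the answer "no" is correct if $y>p-\varepsilon$. For $f,g:2^\omega\to\mathbb R$ write $f\le_{\mathbf m} g$ if for all rational $p$ and $\varepsilon>0$ there are rational $q$ and $\delta>0$ and a continuous $k:2^\omega\to2^\omega$ such that for every $A\in 2^\omega$ every correct answer to $g(k(A))\lesssim_\delta q$ is a correct answer to $f(A)\lesssim_\varepsilon p$. The $\le_{\mathbf m}$-degrees are the equivalence classes of the relation "$f\le_{\mathbf m}g$ and $g\le_{\mathbf m}f$" on the functions $2^\omega\to\mathbb R$. For $f:2^\omega\to\mathbb R$, rational $p$ and rational $\varepsilon>0$ put $C_0=f^{-1}((-\infty,p+\varepsilon))$, $C_1=f^{-1}((p-\varepsilon,\infty))$ and define $P^0=2^\omega$, $P^{\nu+1}=P^\nu\setminus\bigcup\{U \text{ open}: P^\nu\cap U\subseteq C_0\text{ or }P^\nu\cap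 U\subseteq C_1\}$, and $P^\lambda=\bigcap_{\nu<\lambda}P^\nu$ for limit $\lambda$; write $P^\nu_{f,p,\varepsilon}$ for $P^\nu$. For Baire 1 $f$ let $\alpha(f,p,\varepsilon)$ be the least $\nu$ with $P^\nu_{f,p,\varepsilon}=\emptyset$, and let the Bourgain rank be $|f|_\alpha=\sup\{\alpha(f,p,\varepsilon):p,\varepsilon\in\mathbb Q,\ \varepsilon>0\}$. Let $f$ be Baire 1 with $|f|_\alpha=\nu+1$. A pair $(p,\varepsilon)$ (with $\varepsilon>0$) is maximal for $f$ if $\alpha(f,p,\varepsilon)=\nu+1$ and $f(P^\nu_{f,p,\varepsilon})\not\subseteq(p-\varepsilon,p+\varepsilon)$. The function $f$ is two-sided if some maximal $(p,\varepsilon)$ satisfies both $f(P^\nu_{f,p,\varepsilon})\not\subseteq(p-\varepsilon,\infty)$ and $f(P^\nu_{f,p,\varepsilon})\not\subseteq(-\infty,p+\varepsilon)$, and one-sided otherwise; it is left-sided if $f(P^\nu_{f,p,\varepsilon})\subseteq(-\infty,p+\varepsilon)$ for every maximal $(p,\varepsilon)$, and right-sided if $f(P^\nu_{f,p,\varepsilon})\subseteq(p-\varepsilon,\infty)$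 for every maximal $(p,\varepsilon)$. Theorem. Let $f,g:2^\omega\to\mathbb R$ be Baire 1 functions. (a) If $|f|_\alpha<|g|_\alpha$, then $f\le_{\mathbf m}g$. (b) If $|f|_\alpha=|g|_\alpha$, then $f\le_{\mathbf m}g$ if and only if at least one of the following holds: (1) $|f|_\alpha$ is a limit ordinal; (2) $g$ is two-sided; (3) $f$ is one-sided and $g$ is neither right-sided nor left-sided; (4) $f$ and $g$ are both right-sided or both left-sided. (c) For every countable limit ordinal $\nu$, the set of Baire 1 functions $f$ with $|f|_\alpha=\nu$ is (nonempty and) a single $\le_{\mathbf m}$-degree. (d) For every countable ordinal $\nu\ge 1$, the set of Baire 1 functions $f$ with $|f|_\alpha=\nu+1$ is the union of exactly four $\le_{\mathbf m}$-degrees: the two-sided functions; the one-sided functions that are neither left- nor right-sided; the left-sided functions; and the right-sided functions. The two-sided degree is strictly above the second one, the second one is strictly above the left-sided and the right-sided degree, and the left-sided and right-sided degrees are incomparable. (Rank $1$ consists of the continuous functions and is excluded here.) -/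

import Mathlib

open Filter Topology
open scoped Ordinal

/-- Cantor space `2^ω` with the product topology. -/
abbrev Cantor : Type := ℕ → Bool

/-- `f` is a Baire 1 function: a pointwise limit of a sequence of continuous functions. -/
def IsBaireOne (f : Cantor → ℝ) : Prop :=
  ∃ F : ℕ → Cantor → ℝ, (∀ n, Continuous (F n)) ∧ ∀ A, Tendsto (fun n => F n A) atTop (𝓝 (f A))

/-- `b` is a correct answer to the question whether `y` is at most `p` up to the tolerance `ε`:
"yes" (`true`) is correct if `y < p + ε`, and "no" (`false`) is correct if `y > p - ε`. -/
def CorrectAnswer (b : Bool) (y : ℝ) (p ε : ℚ) : Prop :=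
  (b = true ∧ y < (p : ℝ) + ε) ∨ (b = false ∧ (p : ℝ) - ε < y)

/-- The reducibility `f ≤_m g`: every question (with positive rational tolerance) about `f A` is
answered by one single question about `g (k A)`, where `k` is continuous. -/
def MReducible (f g : Cantor → ℝ) : Prop :=
  ∀ p ε : ℚ, 0 < ε → ∃ q δ : ℚ, 0 < δ ∧ ∃ k : Cantor → Cantor, Continuous k ∧
    ∀ (A : Cantor) (b : Bool), CorrectAnswer b (g (k A)) q δ → CorrectAnswer b (f A) p ε

theorem MReducible.refl (f : Cantor → ℝ) : MReducible f f :=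
  fun p ε hε => ⟨p, ε, hε, id, continuous_id, fun _ _ h => h⟩

theorem MReducible.trans {f g h : Cantor → ℝ} (hfg : MReducible f g) (hgh : MReducible g h) :
    MReducible f h := by
  intro p ε hε
  obtain ⟨q, δ, hδ, k, hk, H⟩ := hfg p ε hε
  obtain ⟨r, η, hη, l, hl, K⟩ := hgh q δ hδ
  exact ⟨r, η, hη, l ∘ k, hl.comp hk, fun A b hb => H A b (K (k A) b hb)⟩

/-- The `≤_m`-degree of `f`: its equivalence class among all functions `2^ω → ℝ`. -/
def mDegree (f : Cantor → ℝ) : Set (Cantor → ℝ) :=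
  {h | MReducible h f ∧ MReducible f h}

/-- One derivation step: remove from `P` every open set `U` such that `P ∩ U` is contained in
some member of `𝒞`. -/
def derivStep (𝒞 : Set (Set Cantor)) (P : Set Cantor) : Set Cantor :=
  P \ ⋃₀ {U | IsOpen U ∧ ∃ C ∈ 𝒞, P ∩ U ⊆ C}

/-- The optimal derivation sequence for `𝒞`. -/
noncomputable def optDeriv (𝒞 : Set (Set Cantor)) (ν : Ordinal.{0}) : Set Cantor :=
  Ordinal.limitRecOn ν Set.univ (fun _ P => derivStep 𝒞 P)
    (fun lam _ P => ⋂ (μ : Ordinal.{0}) (h : μ < lam), P μ h)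

theorem optDeriv_zero (𝒞 : Set (Set Cantor)) : optDeriv 𝒞 0 = Set.univ := by
  simp [optDeriv]

theorem optDeriv_succ (𝒞 : Set (Set Cantor)) (ν : Ordinal.{0}) :
    optDeriv 𝒞 (ν + 1) = derivStep 𝒞 (optDeriv 𝒞 ν) := by
  simp [optDeriv]

theorem optDeriv_limit (𝒞 : Set (Set Cantor)) (lam : Ordinal.{0}) (h : Order.IsSuccLimit lam) :
    optDeriv 𝒞 lam = ⋂ (μ : Ordinal.{0}) (_ : μ < lam), optDeriv 𝒞 μ := by
  simp only [optDeriv]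
  rw [Ordinal.limitRecOn_limit _ _ _ _ h]

/-- The set `P^ν_{f,p,ε}`: the optimal derivation sequence for the two preimages
`f⁻¹(-∞, p + ε)` and `f⁻¹(p - ε, ∞)`. -/
noncomputable def bourgainDeriv (f : Cantor → ℝ) (p ε : ℚ) (ν : Ordinal.{0}) : Set Cantor :=
  optDeriv {f ⁻¹' Set.Iio ((p : ℝ) + ε), f ⁻¹' Set.Ioi ((p : ℝ) - ε)} ν

/-- `α(f,p,ε)`: the least `ν` with `P^ν_{f,p,ε} = ∅` (such a `ν` exists for Baire 1 functions `f`
and `ε > 0`). -/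
noncomputable def alphaAt (f : Cantor → ℝ) (p ε : ℚ) : Ordinal.{0} :=
  sInf {ν | bourgainDeriv f p ε ν = ∅}

/-- The Bourgain rank `|f|_α`: the supremum of `α(f,p,ε)` over rational `p` and rational
`ε > 0`. -/
noncomputable def bourgainRank (f : Cantor → ℝ) : Ordinal.{0} :=
  ⨆ x : ℚ × {ε : ℚ // 0 < ε}, alphaAt f x.1 x.2

/-- For `f` of rank `ν + 1`: the pair `(p, ε)` is maximal. -/
def IsMaximalPair (f : Cantor → ℝ) (ν : Ordinal.{0}) (p ε : ℚ) : Prop :=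
  0 < ε ∧ (f '' bourgainDeriv f p ε ν \ Set.Ioo ((p : ℝ) - ε) ((p : ℝ) + ε)).Nonempty ∧
    alphaAt f p ε = ν + 1

/-- `f` has successor rank and is two-sided. -/
def TwoSided (f : Cantor → ℝ) : Prop :=
  ∃ ν : Ordinal.{0}, bourgainRank f = ν + 1 ∧ ∃ p ε : ℚ, IsMaximalPair f ν p ε ∧
    ¬ f '' bourgainDeriv f p ε ν ⊆ Set.Ioi ((p : ℝ) - ε) ∧
    ¬ f '' bourgainDeriv f p ε ν ⊆ Set.Iio ((p : ℝ) + ε)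

/-- `f` has successor rank and is one-sided, that is, not two-sided. -/
def OneSided (f : Cantor → ℝ) : Prop :=
  (∃ ν : Ordinal.{0}, bourgainRank f = ν + 1) ∧ ¬ TwoSided f

/-- `f` has successor rank and is left-sided. -/
def LeftSided (f : Cantor → ℝ) : Prop :=
  ∃ ν : Ordinal.{0}, bourgainRank f = ν + 1 ∧ ∀ p ε : ℚ, IsMaximalPair f ν p ε →
    f '' bourgainDeriv f p ε ν ⊆ Set.Iio ((p : ℝ) + ε)

/-- `f` has successor rank and is right-sided. -/
def RightSided (f : Cantor → ℝ) : Prop :=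
  ∃ ν : Ordinal.{0}, bourgainRank f = ν + 1 ∧ ∀ p ε : ℚ, IsMaximalPair f ν p ε →
    f '' bourgainDeriv f p ε ν ⊆ Set.Ioi ((p : ℝ) - ε)

/-- The rank level `ν`: the Baire 1 functions of Bourgain rank `ν`. -/
def rankLevel (ν : Ordinal.{0}) : Set (Cantor → ℝ) :=
  {f | IsBaireOne f ∧ bourgainRank f = ν}

/-!
The question `(p, ε)` about `f` is determined by the two disjoint sets where only one answer is
correct: `loSet f p ε = {f ≤ p - ε}` (only "yes") and `hiSet f p ε = {p + ε ≤ f}` (only "no").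
A continuous `k` reduces it to the question `(q, δ)` about `g` exactly if `k` maps `loSet f p ε`
into `loSet g q δ` and `hiSet f p ε` into `hiSet g q δ`, and the derivation is
`P^{ν+1} = cl (P^ν ∩ lo) ∩ cl (P^ν ∩ hi)` (`bourgainDeriv_add_one`). Hence a reduction maps the
derivatives of `f` into those of `g`, together with the answers that they force
(`ReducesOn.nonempty_imp`).

Conversely, the derivation tells how to build reductions. By induction on `ν`, a clopen set that is
disjoint from `P^ν_f` can be reduced to any neighbourhood of any point of `P^ν_g`
(`ReducesOn.of_disjoint`): in the successor step the clopen set splits into a part where only "yes"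
and a part where only "no" is forced at stage `ν`; on each part `P^ν_f` is mapped to one suitable
point `y` of `P^ν_g`, and the complement of `P^ν_f` is cut into clopen pieces, which are mapped
by the induction hypothesis to neighbourhoods of `y` that shrink as the pieces approach `P^ν_f`
(`ReducesOn.of_isClosed`). Limit steps hold by compactness. So a question of `f` reduces to any
question of `g` that lasts longer. If both end at the same stage `ν + 1`, then it reduces if and
only if the answers forced on `P^ν_f` are also forced on `P^ν_g`. Since by compactness no single
question ends at a limit stage, this gives the comparison of any two Baire 1 functions by their
ranks and by the answers forced at the last stage.

For the degrees it remains to see that a function reducible to a Baire 1 function is Baire 1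
(`IsBaireOne.of_mReducible`), and that every type occurs. For the former, truncations of `g ∘ k`
separate `{f ≤ a}` from `{b ≤ f}` for `a < b`, and `arctan ∘ f` is a uniform limit of sums of such
functions. For the latter, functions with values `0` and `1` of every countable successor rank
are glued, infinitely often each, along clopen sets converging to one point (`exists_isModel`);
gluing once more with other values gives the remaining types and the limit ranks.
-/

/-! ### The derivation in terms of the sublevel and superlevel sets -/

/-- The points at which "yes" is the only correct answer to the question `(p, ε)` about `f`. -/
def loSet (f : Cantor → ℝ) (p ε : ℚ) : Set Cantor := {x | f x ≤ (p : ℝ) - ε}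

/-- The points at which "no" is the only correct answer to the question `(p, ε)` about `f`. -/
def hiSet (f : Cantor → ℝ) (p ε : ℚ) : Set Cantor := {x | (p : ℝ) + ε ≤ f x}

theorem mem_loSet {f : Cantor → ℝ} {p ε : ℚ} {x : Cantor} :
    x ∈ loSet f p ε ↔ f x ≤ (p : ℝ) - ε := Iff.rfl

theorem mem_hiSet {f : Cantor → ℝ} {p ε : ℚ} {x : Cantor} :
    x ∈ hiSet f p ε ↔ (p : ℝ) + ε ≤ f x := Iff.rfl

theorem bourgainDeriv_zero (f : Cantor → ℝ) (p ε : ℚ) : bourgainDeriv f p ε 0 = Set.univ :=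
  optDeriv_zero _

theorem bourgainDeriv_limit (f : Cantor → ℝ) (p ε : ℚ) {lam : Ordinal.{0}}
    (h : Order.IsSuccLimit lam) :
    bourgainDeriv f p ε lam = ⋂ (μ : Ordinal.{0}) (_ : μ < lam), bourgainDeriv f p ε μ :=
  optDeriv_limit _ _ h

theorem mem_bourgainDeriv_limit {f : Cantor → ℝ} {p ε : ℚ} {lam : Ordinal.{0}}
    (h : Order.IsSuccLimit lam) {x : Cantor} :
    x ∈ bourgainDeriv f p ε lam ↔ ∀ μ < lam, x ∈ bourgainDeriv f p ε μ := by
  rw [bourgainDeriv_limit f p ε h]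
  simp

theorem isClosed_bourgainDeriv (f : Cantor → ℝ) (p ε : ℚ) (ν : Ordinal.{0}) :
    IsClosed (bourgainDeriv f p ε ν) := by
  induction ν using Ordinal.limitRecOn with
  | zero => rw [bourgainDeriv_zero]; exact isClosed_univ
  | add_one ν ih =>
    rw [bourgainDeriv, optDeriv_succ, derivStep]
    exact ih.sdiff (isOpen_sUnion fun U hU => hU.1)
  | limit lam hlam ih =>
    rw [bourgainDeriv_limit f p ε hlam]
    exact isClosed_biInter fun μ hμ => ih μ hμ

/-- A successor step keeps the points that are limits both of remaining points of `loSet` and of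
remaining points of `hiSet`. -/
theorem bourgainDeriv_add_one (f : Cantor → ℝ) (p ε : ℚ) (ν : Ordinal.{0}) :
    bourgainDeriv f p ε (ν + 1) =
      closure (bourgainDeriv f p ε ν ∩ loSet f p ε) ∩
        closure (bourgainDeriv f p ε ν ∩ hiSet f p ε) := by
  have hP := isClosed_bourgainDeriv f p ε ν
  rw [bourgainDeriv, optDeriv_succ, derivStep, ← bourgainDeriv]
  ext x
  simp only [Set.mem_sdiff, Set.mem_sUnion, Set.mem_ofPred_eq, Set.mem_insert_iff,
    Set.mem_singleton_iff, exists_eq_or_imp, exists_eq_left, Set.mem_inter_iff,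
    mem_closure_iff, not_exists, not_and, and_imp]
  constructor
  · rintro ⟨-, H⟩
    refine ⟨fun U hU hxU => ?_, fun U hU hxU => ?_⟩
    · by_contra hne
      refine H U hU (Or.inr fun y hy => ?_) hxU
      by_contra hy'
      exact hne ⟨y, hy.2, hy.1, mem_loSet.2 (not_lt.1 hy')⟩
    · by_contra hne
      refine H U hU (Or.inl fun y hy => ?_) hxU
      by_contra hy'
      exact hne ⟨y, hy.2, hy.1, mem_hiSet.2 (not_lt.1 hy')⟩
  · rintro ⟨hlo, hhi⟩
    refine ⟨?_, fun U hU hC hxU => ?_⟩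
    · rw [← hP.closure_eq, mem_closure_iff]
      intro U hU hxU
      obtain ⟨y, hyU, hyP, -⟩ := hlo U hU hxU
      exact ⟨y, hyU, hyP⟩
    · rcases hC with hC | hC
      · obtain ⟨y, hyU, hyP, hy⟩ := hhi U hU hxU
        exact (not_lt.2 (mem_hiSet.1 hy)) (Set.mem_Iio.1 (hC ⟨hyP, hyU⟩))
      · obtain ⟨y, hyU, hyP, hy⟩ := hlo U hU hxU
        exact (not_lt.2 (mem_loSet.1 hy)) (Set.mem_Ioi.1 (hC ⟨hyP, hyU⟩))

theorem bourgainDeriv_antitone (f : Cantor → ℝ) (p ε : ℚ) : Antitone (bourgainDeriv f p ε) := by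
  intro μ ν h
  induction ν using Ordinal.limitRecOn with
  | zero => rw [nonpos_iff_eq_zero.1 h]
  | add_one ν ih =>
    rcases h.lt_or_eq with h | rfl
    · refine subset_trans ?_ (ih (Order.lt_add_one_iff.1 h))
      rw [bourgainDeriv, optDeriv_succ]
      exact Set.sdiff_subset
    · exact subset_rfl
  | limit lam hlam ih =>
    rcases h.lt_or_eq with h | rfl
    · exact fun x hx => (mem_bourgainDeriv_limit hlam).1 hx μ h
    · exact subset_rfl

/-- Continuous maps that respect the two forced answers respect the derivatives. -/
theorem mapsTo_bourgainDeriv {f g : Cantor → ℝ} {p ε q δ : ℚ} {k : Cantor → Cantor}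
    (hk : Continuous k) (hlo : Set.MapsTo k (loSet f p ε) (loSet g q δ))
    (hhi : Set.MapsTo k (hiSet f p ε) (hiSet g q δ)) (ν : Ordinal.{0}) :
    Set.MapsTo k (bourgainDeriv f p ε ν) (bourgainDeriv g q δ ν) := by
  induction ν using Ordinal.limitRecOn with
  | zero => simp [bourgainDeriv_zero, Set.mapsTo_univ]
  | add_one ν ih =>
    rw [bourgainDeriv_add_one, bourgainDeriv_add_one]
    exact ((ih.inter_inter hlo).closure hk).inter_inter ((ih.inter_inter hhi).closure hk)
  | limit lam hlam ih =>
    intro x hx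
    rw [mem_bourgainDeriv_limit hlam] at hx ⊢
    exact fun μ hμ => ih μ hμ (hx μ hμ)

theorem bourgainDeriv_subset {f g : Cantor → ℝ} {p ε q δ : ℚ}
    (hlo : loSet f p ε ⊆ loSet g q δ) (hhi : hiSet f p ε ⊆ hiSet g q δ) (ν : Ordinal.{0}) :
    bourgainDeriv f p ε ν ⊆ bourgainDeriv g q δ ν :=
  mapsTo_bourgainDeriv (k := id) continuous_id hlo hhi ν

/-- The derivation is local: it commutes with pulling back along a continuous open map. -/
theorem preimage_bourgainDeriv {h : Cantor → Cantor} (hc : Continuous h) (ho : IsOpenMap h)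
    (f : Cantor → ℝ) (p ε : ℚ) (ν : Ordinal.{0}) :
    h ⁻¹' bourgainDeriv f p ε ν = bourgainDeriv (f ∘ h) p ε ν := by
  induction ν using Ordinal.limitRecOn with
  | zero => simp [bourgainDeriv_zero]
  | add_one ν ih =>
    rw [bourgainDeriv_add_one, bourgainDeriv_add_one, Set.preimage_inter,
      ho.preimage_closure_eq_closure_preimage hc, ho.preimage_closure_eq_closure_preimage hc,
      Set.preimage_inter, Set.preimage_inter, ih]
    rfl
  | limit lam hlam ih =>
    ext x
    rw [Set.mem_preimage, mem_bourgainDeriv_limit hlam, mem_bourgainDeriv_limit hlam]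
    exact forall₂_congr fun μ hμ => by rw [← ih μ hμ, Set.mem_preimage]

/-- By compactness, a closed set leaves the derivation already before a limit stage. -/
theorem exists_lt_disjoint_bourgainDeriv {f : Cantor → ℝ} {p ε : ℚ} {lam : Ordinal.{0}}
    (hlam : Order.IsSuccLimit lam) {U : Set Cantor} (hU : IsClosed U)
    (hd : Disjoint U (bourgainDeriv f p ε lam)) :
    ∃ μ < lam, Disjoint U (bourgainDeriv f p ε μ) := by
  have : Nonempty (Set.Iio lam) :=
    ⟨⟨0, Set.mem_Iio.2 (pos_iff_ne_zero.2 (Ordinal.isSuccLimit_iff.1 hlam).1)⟩⟩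
  obtain ⟨⟨μ, hμ⟩, h⟩ := hU.isCompact.elim_directed_family_closed
    (fun μ : Set.Iio lam => bourgainDeriv f p ε μ) (fun μ => isClosed_bourgainDeriv f p ε μ)
    (by
      rw [bourgainDeriv_limit f p ε hlam, Set.disjoint_iff_inter_eq_empty] at hd
      rw [← hd, Set.iInter_subtype]
      rfl)
    (Antitone.directed_ge fun μ ν h => bourgainDeriv_antitone f p ε h)
  exact ⟨μ, hμ, Set.disjoint_iff_inter_eq_empty.2 h⟩

/-! ### The rank of a Baire 1 function -/

theorem IsBaireOne.isGδ_le {f : Cantor → ℝ} (hf : IsBaireOne f) (c : ℝ) : IsGδ {x | f x ≤ c} := by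
  obtain ⟨F, hF, hlim⟩ := hf
  -- `f x ≤ c` iff for every `m`, `F n x < c + 1 / (m + 1)` happens for arbitrarily large `n`
  have : {x | f x ≤ c} =
      ⋂ m : ℕ, ⋂ N : ℕ, ⋃ n : ℕ, ⋃ _ : N ≤ n, {x | F n x < c + 1 / ((m : ℝ) + 1)} := by
    ext x
    simp only [Set.mem_ofPred_eq, Set.mem_iInter, Set.mem_iUnion, exists_prop]
    constructor
    · intro hx m N
      have h1 : f x < c + 1 / ((m : ℝ) + 1) := by
        have : (0 : ℝ) < 1 / ((m : ℝ) + 1) := by positivity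
        linarith
      have h2 := (hlim x).eventually_lt_const h1
      obtain ⟨n, hn, hN⟩ := (h2.and (eventually_ge_atTop N)).exists
      exact ⟨n, hN, hn⟩
    · intro H
      by_contra! hx
      obtain ⟨m, hm⟩ := exists_nat_one_div_lt (sub_pos.2 hx)
      have h1 : c + 1 / ((m : ℝ) + 1) < f x := by linarith
      obtain ⟨N, hN⟩ := ((hlim x).eventually_const_lt h1).exists_forall_of_atTop
      obtain ⟨n, hn, hlt⟩ := H m N
      exact lt_asymm hlt (hN n hn)
  rw [this]
  refine .iInter fun m => .iInter fun N => IsOpen.isGδ ?_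
  exact isOpen_biUnion fun n _ => isOpen_lt (hF n) continuous_const

theorem IsBaireOne.neg {f : Cantor → ℝ} (hf : IsBaireOne f) : IsBaireOne (fun x => -f x) := by
  obtain ⟨F, hF, hlim⟩ := hf
  exact ⟨fun n x => -F n x, fun n => (hF n).neg, fun x => (hlim x).neg⟩

theorem isGδ_hiSet {f : Cantor → ℝ} (hf : IsBaireOne f) (p ε : ℚ) : IsGδ (hiSet f p ε) := by
  have h : hiSet f p ε = {x | -f x ≤ -((p : ℝ) + ε)} := by
    ext x
    rw [mem_hiSet, Set.mem_ofPred_eq, neg_le_neg_iff]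
  rw [h]
  exact hf.neg.isGδ_le _

/-- Where the derivation stabilizes, both forced sets are dense `Gδ` subsets of the remaining
closed set; they are disjoint, so by Baire's theorem nothing remains. -/
theorem exists_bourgainDeriv_eq_empty {f : Cantor → ℝ} (hf : IsBaireOne f) (p : ℚ) {ε : ℚ}
    (hε : 0 < ε) : ∃ ν : Ordinal.{0}, bourgainDeriv f p ε ν = ∅ := by
  obtain ⟨ν, hν⟩ : ∃ ν, bourgainDeriv f p ε (ν + 1) = bourgainDeriv f p ε ν := by
    by_contra! H
    refine not_injective_of_ordinal (bourgainDeriv f p ε) (StrictAnti.injective ?_)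
    intro μ ν h
    refine lt_of_le_of_lt (bourgainDeriv_antitone f p ε (Order.add_one_le_of_lt h)) ?_
    exact lt_of_le_of_ne (bourgainDeriv_antitone f p ε (Order.le_succ μ)) (H μ)
  refine ⟨ν, Set.not_nonempty_iff_eq_empty.1 fun hne => ?_⟩
  set P := bourgainDeriv f p ε ν with hP
  have hPc : IsClosed P := isClosed_bourgainDeriv f p ε ν
  have hdense : ∀ S : Set Cantor, P ⊆ closure (P ∩ S) → Dense ((↑) ⁻¹' S : Set P) := by
    intro S hS x
    rw [closure_subtype, Subtype.image_preimage_coe]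
    exact hS x.2
  rw [bourgainDeriv_add_one, ← hP] at hν
  have h1 := hdense (loSet f p ε) (hν.symm.subset.trans Set.inter_subset_left)
  have h2 := hdense (hiSet f p ε) (hν.symm.subset.trans Set.inter_subset_right)
  have : CompactSpace P := isCompact_iff_compactSpace.1 hPc.isCompact
  have : Nonempty P := hne.to_subtype
  obtain ⟨x, hx1, hx2⟩ := (Dense.inter_of_Gδ
    ((hf.isGδ_le _).preimage continuous_subtype_val)
    ((isGδ_hiSet hf p ε).preimage continuous_subtype_val) h1 h2).nonempty
  have h3 : f x ≤ (p : ℝ) - ε := hx1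
  have h4 : (p : ℝ) + ε ≤ f x := hx2
  have : (0 : ℝ) < ε := by exact_mod_cast hε
  linarith

theorem bourgainDeriv_alphaAt {f : Cantor → ℝ} (hf : IsBaireOne f) (p : ℚ) {ε : ℚ}
    (hε : 0 < ε) : bourgainDeriv f p ε (alphaAt f p ε) = ∅ :=
  csInf_mem (exists_bourgainDeriv_eq_empty hf p hε)

theorem alphaAt_le_of_eq_empty {f : Cantor → ℝ} {p ε : ℚ} {ν : Ordinal.{0}}
    (h : bourgainDeriv f p ε ν = ∅) : alphaAt f p ε ≤ ν :=
  csInf_le' h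

theorem bourgainDeriv_nonempty_of_lt {f : Cantor → ℝ} {p ε : ℚ} {ν : Ordinal.{0}}
    (h : ν < alphaAt f p ε) : (bourgainDeriv f p ε ν).Nonempty := by
  by_contra hne
  exact absurd (alphaAt_le_of_eq_empty (Set.not_nonempty_iff_eq_empty.1 hne)) (not_le.2 h)

theorem bourgainDeriv_eq_empty_of_alphaAt_le {f : Cantor → ℝ} (hf : IsBaireOne f) {p ε : ℚ}
    (hε : 0 < ε) {ν : Ordinal.{0}} (h : alphaAt f p ε ≤ ν) : bourgainDeriv f p ε ν = ∅ :=
  Set.subset_empty_iff.1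
    ((bourgainDeriv_antitone f p ε h).trans (bourgainDeriv_alphaAt hf p hε).subset)

theorem lt_alphaAt {f : Cantor → ℝ} (hf : IsBaireOne f) {p ε : ℚ} (hε : 0 < ε)
    {ν : Ordinal.{0}} (h : (bourgainDeriv f p ε ν).Nonempty) : ν < alphaAt f p ε := by
  by_contra! hle
  exact h.ne_empty (bourgainDeriv_eq_empty_of_alphaAt_le hf hε hle)

/-- The derivation never reaches the empty set exactly at a limit stage. -/
theorem not_isSuccLimit_alphaAt {f : Cantor → ℝ} (hf : IsBaireOne f) {p ε : ℚ} (hε : 0 < ε) :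
    ¬ Order.IsSuccLimit (alphaAt f p ε) := by
  intro h
  obtain ⟨μ, hμ, hd⟩ := exists_lt_disjoint_bourgainDeriv h isClosed_univ
    (by rw [bourgainDeriv_alphaAt hf p hε]; exact Set.disjoint_empty _)
  exact (bourgainDeriv_nonempty_of_lt hμ).ne_empty (Set.univ_disjoint.1 hd)

theorem alphaAt_le_bourgainRank (f : Cantor → ℝ) (p : ℚ) {ε : ℚ} (hε : 0 < ε) :
    alphaAt f p ε ≤ bourgainRank f :=
  Ordinal.le_iSup (fun x : ℚ × {ε : ℚ // 0 < ε} => alphaAt f x.1 x.2) ⟨p, ε, hε⟩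

theorem lt_bourgainRank_iff {f : Cantor → ℝ} {ν : Ordinal.{0}} :
    ν < bourgainRank f ↔ ∃ p ε : ℚ, 0 < ε ∧ ν < alphaAt f p ε := by
  rw [bourgainRank, Ordinal.lt_iSup_iff]
  exact ⟨fun ⟨x, hx⟩ => ⟨x.1, x.2, x.2.2, hx⟩, fun ⟨p, ε, hε, h⟩ => ⟨⟨p, ε, hε⟩, h⟩⟩

theorem bourgainRank_le {f : Cantor → ℝ} {ν : Ordinal.{0}}
    (h : ∀ p ε : ℚ, 0 < ε → bourgainDeriv f p ε ν = ∅) : bourgainRank f ≤ ν :=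
  Ordinal.iSup_le fun x => alphaAt_le_of_eq_empty (h x.1 x.2 x.2.2)

theorem bourgainDeriv_bourgainRank {f : Cantor → ℝ} (hf : IsBaireOne f) (p : ℚ) {ε : ℚ}
    (hε : 0 < ε) : bourgainDeriv f p ε (bourgainRank f) = ∅ :=
  bourgainDeriv_eq_empty_of_alphaAt_le hf hε (alphaAt_le_bourgainRank f p hε)

/-! ### Building reductions along the derivation -/

theorem exists_cylinder_subset {x : Cantor} {V : Set Cantor} (hV : V ∈ 𝓝 x) :
    ∃ n, PiNat.cylinder x n ⊆ V := by
  obtain ⟨_, ⟨z, n, rfl⟩, hx, hsub⟩ :=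
    (PiNat.isTopologicalBasis_cylinders fun _ : ℕ => Bool).mem_nhds_iff.1 hV
  exact ⟨n, (PiNat.mem_cylinder_iff_eq.1 hx).subset.trans hsub⟩

theorem cylinder_mem_nhds (x : Cantor) (n : ℕ) : PiNat.cylinder x n ∈ 𝓝 x :=
  (PiNat.isOpen_cylinder _ x n).mem_nhds (PiNat.self_mem_cylinder x n)

/-- A set that depends on the first `n` coordinates only is clopen. -/
theorem isClopen_of_forall_mem_cylinder {S : Set Cantor} (n : ℕ)
    (h : ∀ x ∈ S, PiNat.cylinder x n ⊆ S) : IsClopen S := by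
  constructor
  · rw [← isOpen_compl_iff, isOpen_iff_mem_nhds]
    intro x hx
    refine mem_of_superset (cylinder_mem_nhds x n) fun y hy hyS => hx ?_
    exact h y hyS ((PiNat.mem_cylinder_comm x y n).1 hy)
  · exact isOpen_iff_mem_nhds.2 fun x hx => mem_of_superset (cylinder_mem_nhds x n) (h x hx)

/-- On the set `U`, the question `(p, ε)` about `f` reduces to the question `(q, δ)` about `g` by a
continuous map with values in `V`. -/
def ReducesOn (f : Cantor → ℝ) (p ε : ℚ) (g : Cantor → ℝ) (q δ : ℚ) (U V : Set Cantor) : Prop :=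
  ∃ k : Cantor → Cantor, ContinuousOn k U ∧ ∀ x ∈ U,
    k x ∈ V ∧ (x ∈ loSet f p ε → k x ∈ loSet g q δ) ∧ (x ∈ hiSet f p ε → k x ∈ hiSet g q δ)

section reductions

variable {f g : Cantor → ℝ} {p ε q δ : ℚ}

theorem forall_correctAnswer_iff {x y : ℝ} :
    (∀ b, CorrectAnswer b y q δ → CorrectAnswer b x p ε) ↔
      (x ≤ (p : ℝ) - ε → y ≤ (q : ℝ) - δ) ∧ ((p : ℝ) + ε ≤ x → (q : ℝ) + δ ≤ y) := by
  simp only [CorrectAnswer, Bool.forall_bool, Bool.false_eq_true, false_and, true_and, false_or,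
    Bool.true_eq_false, or_false]
  exact and_congr (by rw [← not_imp_not, not_lt, not_lt]) (by rw [← not_imp_not, not_lt, not_lt])

theorem mReducible_iff :
    MReducible f g ↔ ∀ p ε : ℚ, 0 < ε → ∃ q δ : ℚ, 0 < δ ∧
      ReducesOn f p ε g q δ Set.univ Set.univ := by
  simp only [MReducible, ReducesOn, forall_correctAnswer_iff, continuousOn_univ, Set.mem_univ,
    true_and, true_implies, mem_loSet, mem_hiSet]

theorem ReducesOn.mono {U U' V V' : Set Cantor} (h : ReducesOn f p ε g q δ U V) (hU : U' ⊆ U)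
    (hV : V ⊆ V') : ReducesOn f p ε g q δ U' V' := by
  obtain ⟨k, hk, H⟩ := h
  exact ⟨k, hk.mono hU, fun x hx => ⟨hV (H x (hU hx)).1, (H x (hU hx)).2⟩⟩

theorem ReducesOn.of_inter_diff {U E V : Set Cantor} (hE : IsClopen E)
    (h₁ : ReducesOn f p ε g q δ (U ∩ E) V) (h₂ : ReducesOn f p ε g q δ (U \ E) V) :
    ReducesOn f p ε g q δ U V := by
  classical
  obtain ⟨k₁, hk₁, H₁⟩ := h₁
  obtain ⟨k₂, hk₂, H₂⟩ := h₂
  refine ⟨E.piecewise k₁ k₂, fun x hx => ?_, fun x hx => ?_⟩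
  · by_cases hxE : x ∈ E
    · have h1 : ContinuousWithinAt k₁ U x :=
        (hk₁ x ⟨hx, hxE⟩).mono_of_mem_nhdsWithin
          (inter_mem_nhdsWithin _ (hE.isOpen.mem_nhds hxE))
      refine h1.congr_of_eventuallyEq ?_ (Set.piecewise_eq_of_mem _ _ _ hxE)
      filter_upwards [mem_nhdsWithin_of_mem_nhds (hE.isOpen.mem_nhds hxE)] with y hy
      exact Set.piecewise_eq_of_mem _ _ _ hy
    · have h1 : ContinuousWithinAt k₂ U x :=
        (hk₂ x ⟨hx, hxE⟩).mono_of_mem_nhdsWithin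
          (inter_mem_nhdsWithin _ (hE.compl.isOpen.mem_nhds hxE))
      refine h1.congr_of_eventuallyEq ?_ (Set.piecewise_eq_of_notMem _ _ _ hxE)
      filter_upwards [mem_nhdsWithin_of_mem_nhds (hE.compl.isOpen.mem_nhds hxE)] with y hy
      exact Set.piecewise_eq_of_notMem _ _ _ hy
  · by_cases hxE : x ∈ E
    · rw [Set.piecewise_eq_of_mem _ _ _ hxE]
      exact H₁ x ⟨hx, hxE⟩
    · rw [Set.piecewise_eq_of_notMem _ _ _ hxE]
      exact H₂ x ⟨hx, hxE⟩

/-- A reduction that is constant on a closed set `P`: the complement of `P` splits into countably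
many clopen pieces, and the pieces close to `P` are mapped to small neighbourhoods of the
constant value `y`. -/
theorem ReducesOn.of_isClosed {P U V : Set Cantor} (hP : IsClosed P)
    {y : Cantor} (hV : V ∈ 𝓝 y)
    (hlo : (U ∩ P ∩ loSet f p ε).Nonempty → y ∈ loSet g q δ)
    (hhi : (U ∩ P ∩ hiSet f p ε).Nonempty → y ∈ hiSet g q δ)
    (H : ∀ W, IsClopen W → Disjoint W P → ∀ V' ∈ 𝓝 y, ReducesOn f p ε g q δ W V') :
    ReducesOn f p ε g q δ U V := by
  classical
  -- the points that are separated from `P` by their first `n` coordinates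
  let D : ℕ → Set Cantor := fun n => {x | Disjoint (PiNat.cylinder x n) P}
  have hD : ∀ n, IsClopen (D n) := fun n => isClopen_of_forall_mem_cylinder n fun x hx z hz => by
    have : Disjoint (PiNat.cylinder z n) P := by
      rw [PiNat.mem_cylinder_iff_eq.1 hz]
      exact hx
    exact this
  have hDP : ∀ n, Disjoint (D n) P := fun n => Set.disjoint_left.2 fun x hx hxP =>
    Set.disjoint_left.1 (show Disjoint (PiNat.cylinder x n) P from hx)
      (PiNat.self_mem_cylinder x n) hxP
  have hDm : Monotone D := fun m n hmn x hx =>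
    Set.disjoint_of_subset_left (PiNat.cylinder_anti x hmn) hx
  have hex : ∀ x, x ∉ P → ∃ n, x ∈ D n := fun x hx => by
    obtain ⟨n, hn⟩ := exists_cylinder_subset (hP.isOpen_compl.mem_nhds hx)
    exact ⟨n, Set.disjoint_left.2 fun z hz => hn hz⟩
  choose k hk Hk using fun n => H (D n) (hD n) (hDP n) (V ∩ PiNat.cylinder y n)
    (inter_mem hV (cylinder_mem_nhds y n))
  let K : Cantor → Cantor := fun x => if hx : ∃ n, x ∈ D n then k (Nat.find hx) x else y
  have hKn : ∀ x (hx : ∃ n, x ∈ D n), K x = k (Nat.find hx) x := fun x hx => dif_pos hx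
  have hKy : ∀ x ∈ P, K x = y := fun x hx => dif_neg fun ⟨n, hn⟩ =>
    Set.disjoint_left.1 (hDP n) hn hx
  refine ⟨K, Continuous.continuousOn (continuous_iff_continuousAt.2 fun x => ?_), fun x hx => ?_⟩
  · by_cases hxP : x ∈ P
    · rw [ContinuousAt, hKy x hxP]
      intro N hN
      obtain ⟨n, hn⟩ := exists_cylinder_subset hN
      have hxD : x ∉ D n := fun h => Set.disjoint_left.1 (hDP n) h hxP
      rw [mem_map]
      filter_upwards [(hD n).compl.isOpen.mem_nhds hxD] with z hz
      refine hn ?_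
      by_cases hzD : ∃ m, z ∈ D m
      · rw [hKn z hzD]
        have hle : n ≤ Nat.find hzD := by
          by_contra! hlt
          exact hz (hDm hlt.le (Nat.find_spec hzD))
        exact PiNat.cylinder_anti y hle (Hk _ z (Nat.find_spec hzD)).1.2
      · have : K z = y := dif_neg hzD
        rw [this]
        exact PiNat.self_mem_cylinder y n
    · have hxD := hex x hxP
      -- near `x` the least `n` with `z ∈ D n` does not change
      have hev : ∀ᶠ z in 𝓝 x, z ∈ D (Nat.find hxD) ∧ ∀ m < Nat.find hxD, z ∉ D m := by
        refine Filter.Eventually.and ((hD _).isOpen.mem_nhds (Nat.find_spec hxD)) ?_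
        refine (Set.finite_lt_nat _).eventually_all.2 fun m hm => ?_
        exact (hD m).compl.isOpen.mem_nhds (Nat.find_min hxD hm)
      have hcont : ContinuousAt (k (Nat.find hxD)) x :=
        (hk _).continuousAt ((hD _).isOpen.mem_nhds (Nat.find_spec hxD))
      refine hcont.congr ?_
      filter_upwards [hev] with z hz
      rw [hKn z ⟨_, hz.1⟩]
      have : Nat.find (⟨_, hz.1⟩ : ∃ n, z ∈ D n) = Nat.find hxD :=
        (Nat.find_eq_iff _).2 hz
      rw [this]
  · by_cases hxP : x ∈ P
    · rw [hKy x hxP]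
      exact ⟨mem_of_mem_nhds hV, fun h => hlo ⟨x, ⟨hx, hxP⟩, h⟩, fun h => hhi ⟨x, ⟨hx, hxP⟩, h⟩⟩
    · have hxD := hex x hxP
      rw [hKn x hxD]
      have := Hk _ x (Nat.find_spec hxD)
      exact ⟨this.1.1, this.2⟩

/-- The extension step: if the parts of `f` that vanish by stage `ν` reduce to neighbourhoods of
the points of the `ν`-th derivative of `g`, then so does a set `U` whose remaining points
at stage `ν` force at most the answers that `y` forces. -/
theorem ReducesOn.of_mem_bourgainDeriv {ν : Ordinal.{0}}
    (H : ∀ W, IsClopen W → Disjoint W (bourgainDeriv f p ε ν) →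
      ∀ y ∈ bourgainDeriv g q δ ν, ∀ V ∈ 𝓝 y, ReducesOn f p ε g q δ W V)
    {U V : Set Cantor} {y : Cantor} (hy : y ∈ bourgainDeriv g q δ ν)
    (hV : V ∈ 𝓝 y)
    (hlo : (U ∩ bourgainDeriv f p ε ν ∩ loSet f p ε).Nonempty → y ∈ loSet g q δ)
    (hhi : (U ∩ bourgainDeriv f p ε ν ∩ hiSet f p ε).Nonempty → y ∈ hiSet g q δ) :
    ReducesOn f p ε g q δ U V :=
  .of_isClosed (isClosed_bourgainDeriv f p ε ν) hV hlo hhi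
    fun W hW hWd V' hV' => H W hW hWd y hy V' hV'

/-- If `U` is disjoint from the next derivative, it splits into a clopen part on which "no" is
never forced at stage `ν` and one on which "yes" is never forced at stage `ν`. -/
theorem exists_isClopen_separating {ν : Ordinal.{0}} {U : Set Cantor} (hU : IsClopen U)
    (hd : Disjoint U (bourgainDeriv f p ε (ν + 1))) :
    ∃ E, IsClopen E ∧ ¬ (U ∩ E ∩ bourgainDeriv f p ε ν ∩ hiSet f p ε).Nonempty ∧
      ¬ (U \ E ∩ bourgainDeriv f p ε ν ∩ loSet f p ε).Nonempty := by
  rw [bourgainDeriv_add_one] at hd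
  obtain ⟨E, hE, hsub, hsub'⟩ := exists_clopen_of_closed_subset_open
    (hU.isClosed.inter (isClosed_closure (s := bourgainDeriv f p ε ν ∩ loSet f p ε)))
    (isClosed_closure (s := bourgainDeriv f p ε ν ∩ hiSet f p ε)).isOpen_compl
    (fun x hx hx' => Set.disjoint_left.1 hd hx.1 ⟨hx.2, hx'⟩)
  refine ⟨E, hE, ?_, ?_⟩
  · rintro ⟨x, ⟨⟨-, hxE⟩, hxP⟩, hx⟩
    exact hsub' hxE (subset_closure ⟨hxP, hx⟩)
  · rintro ⟨x, ⟨⟨hxU, hxE⟩, hxP⟩, hx⟩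
    exact hxE (hsub ⟨hxU, subset_closure ⟨hxP, hx⟩⟩)

/-- What has left the derivation of `f` by stage `ν` can be reduced to any neighbourhood of any
point that `g` still has at stage `ν`. -/
theorem ReducesOn.of_disjoint (ν : Ordinal.{0}) : ∀ U, IsClopen U →
    Disjoint U (bourgainDeriv f p ε ν) →
      ∀ y ∈ bourgainDeriv g q δ ν, ∀ V ∈ 𝓝 y, ReducesOn f p ε g q δ U V := by
  induction ν using Ordinal.limitRecOn with
  | zero =>
    intro U _ hd y _ V _
    rw [bourgainDeriv_zero, Set.disjoint_univ] at hd
    subst hd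
    exact ⟨id, continuousOn_empty _, fun x hx => absurd hx (Set.notMem_empty x)⟩
  | add_one ν ih =>
    intro U hU hd y hy V hV
    obtain ⟨E, hE, h₁, h₂⟩ := exists_isClopen_separating hU hd
    rw [bourgainDeriv_add_one] at hy
    obtain ⟨y₁, hy₁V, hy₁, hy₁lo⟩ := mem_closure_iff_nhds.1 hy.1 _ (interior_mem_nhds.2 hV)
    obtain ⟨y₂, hy₂V, hy₂, hy₂hi⟩ := mem_closure_iff_nhds.1 hy.2 _ (interior_mem_nhds.2 hV)
    exact .of_inter_diff hE
      (.of_mem_bourgainDeriv ih hy₁ (mem_interior_iff_mem_nhds.1 hy₁V)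
        (fun _ => hy₁lo) (fun h => absurd h h₁))
      (.of_mem_bourgainDeriv ih hy₂ (mem_interior_iff_mem_nhds.1 hy₂V)
        (fun h => absurd h h₂) (fun _ => hy₂hi))
  | limit lam hlam ih =>
    intro U hU hd y hy V hV
    obtain ⟨μ, hμ, hdμ⟩ := exists_lt_disjoint_bourgainDeriv hlam hU.isClosed hd
    exact ih μ hμ U hU hdμ y ((mem_bourgainDeriv_limit hlam).1 hy μ hμ) V hV

/-- At stage `ν` there is still a point at which "yes" is the only correct answer. -/
def ForcesYes (f : Cantor → ℝ) (p ε : ℚ) (ν : Ordinal.{0}) : Prop :=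
  (bourgainDeriv f p ε ν ∩ loSet f p ε).Nonempty

/-- At stage `ν` there is still a point at which "no" is the only correct answer. -/
def ForcesNo (f : Cantor → ℝ) (p ε : ℚ) (ν : Ordinal.{0}) : Prop :=
  (bourgainDeriv f p ε ν ∩ hiSet f p ε).Nonempty

theorem ReducesOn.of_eq_empty {ν : Ordinal.{0}} (hf : bourgainDeriv f p ε ν = ∅)
    (hg : (bourgainDeriv g q δ ν).Nonempty) : ReducesOn f p ε g q δ Set.univ Set.univ := by
  obtain ⟨y, hy⟩ := hg
  exact .of_disjoint ν _ isClopen_univ (by rw [hf]; exact Set.disjoint_empty _) y hy _ univ_mem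

/-- A single point `y` of the last derivative of `g` suffices if the last derivative of `f` forces
at most the answers that `y` forces. -/
theorem ReducesOn.of_point {ν : Ordinal.{0}} {y : Cantor} (hy : y ∈ bourgainDeriv g q δ ν)
    (hlo : ForcesYes f p ε ν → y ∈ loSet g q δ)
    (hhi : ForcesNo f p ε ν → y ∈ hiSet g q δ) :
    ReducesOn f p ε g q δ Set.univ Set.univ :=
  .of_mem_bourgainDeriv (.of_disjoint ν) hy univ_mem
    (by rw [Set.univ_inter]; exact hlo) (by rw [Set.univ_inter]; exact hhi)

/-- If the last derivative of `g` forces both answers, every `f` that lasts no longer than `g`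
reduces to `g`. -/
theorem ReducesOn.of_two_points {ν : Ordinal.{0}} (hf : bourgainDeriv f p ε (ν + 1) = ∅)
    (hlo : ForcesYes g q δ ν)
    (hhi : ForcesNo g q δ ν) :
    ReducesOn f p ε g q δ Set.univ Set.univ := by
  obtain ⟨y₁, hy₁, hlo⟩ := hlo
  obtain ⟨y₂, hy₂, hhi⟩ := hhi
  obtain ⟨E, hE, h₁, h₂⟩ := exists_isClopen_separating (f := f) (p := p) (ε := ε) (ν := ν)
    isClopen_univ (by rw [hf]; exact Set.disjoint_empty _)
  exact .of_inter_diff hE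
    (.of_mem_bourgainDeriv (.of_disjoint ν) hy₁ univ_mem
      (fun _ => hlo) (fun h => absurd h h₁))
    (.of_mem_bourgainDeriv (.of_disjoint ν) hy₂ univ_mem
      (fun h => absurd h h₂) (fun _ => hhi))

/-- A reduction carries the derivatives of `f`, and the answers forced on them, to those of `g`. -/
theorem ReducesOn.nonempty_imp (h : ReducesOn f p ε g q δ Set.univ Set.univ) (ν : Ordinal.{0}) :
    ((bourgainDeriv f p ε ν).Nonempty → (bourgainDeriv g q δ ν).Nonempty) ∧
    (ForcesYes f p ε ν →
      ForcesYes g q δ ν) ∧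
    (ForcesNo f p ε ν →
      ForcesNo g q δ ν) := by
  obtain ⟨k, hk, H⟩ := h
  have hlo : Set.MapsTo k (loSet f p ε) (loSet g q δ) := fun x hx => (H x trivial).2.1 hx
  have hhi : Set.MapsTo k (hiSet f p ε) (hiSet g q δ) := fun x hx => (H x trivial).2.2 hx
  have hP := mapsTo_bourgainDeriv (continuousOn_univ.1 hk) hlo hhi ν
  exact ⟨fun h => h.image k |>.mono hP.image_subset,
    fun h => h.image k |>.mono (hP.inter_inter hlo).image_subset,
    fun h => h.image k |>.mono (hP.inter_inter hhi).image_subset⟩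

end reductions

/-! ### Sidedness -/

theorem ForcesYes.nonempty {f : Cantor → ℝ} {p ε : ℚ} {ν : Ordinal.{0}} (h : ForcesYes f p ε ν) :
    (bourgainDeriv f p ε ν).Nonempty := h.mono Set.inter_subset_left

theorem ForcesNo.nonempty {f : Cantor → ℝ} {p ε : ℚ} {ν : Ordinal.{0}} (h : ForcesNo f p ε ν) :
    (bourgainDeriv f p ε ν).Nonempty := h.mono Set.inter_subset_left

theorem not_image_subset_Ioi_iff {f : Cantor → ℝ} {p ε : ℚ} {ν : Ordinal.{0}} :
    ¬ f '' bourgainDeriv f p ε ν ⊆ Set.Ioi ((p : ℝ) - ε) ↔ ForcesYes f p ε ν := by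
  rw [Set.image_subset_iff, Set.not_subset]
  exact exists_congr fun x => and_congr_right fun _ => by
    rw [Set.mem_preimage, Set.mem_Ioi, not_lt, mem_loSet]

theorem not_image_subset_Iio_iff {f : Cantor → ℝ} {p ε : ℚ} {ν : Ordinal.{0}} :
    ¬ f '' bourgainDeriv f p ε ν ⊆ Set.Iio ((p : ℝ) + ε) ↔ ForcesNo f p ε ν := by
  rw [Set.image_subset_iff, Set.not_subset]
  exact exists_congr fun x => and_congr_right fun _ => by
    rw [Set.mem_preimage, Set.mem_Iio, not_lt, mem_hiSet]

theorem isMaximalPair_iff {f : Cantor → ℝ} (hf : IsBaireOne f) {ν : Ordinal.{0}}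
    (hr : bourgainRank f = ν + 1) {p ε : ℚ} :
    IsMaximalPair f ν p ε ↔ 0 < ε ∧ (ForcesYes f p ε ν ∨ ForcesNo f p ε ν) := by
  refine and_congr_right fun hε => ?_
  have h1 : (f '' bourgainDeriv f p ε ν \ Set.Ioo ((p : ℝ) - ε) ((p : ℝ) + ε)).Nonempty ↔
      ForcesYes f p ε ν ∨ ForcesNo f p ε ν := by
    rw [Set.sdiff_nonempty, ← not_image_subset_Ioi_iff, ← not_image_subset_Iio_iff, ← not_and_or,
      ← Set.subset_inter_iff, Set.Ioi_inter_Iio]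
  rw [h1]
  refine and_iff_left_of_imp fun h => le_antisymm ?_ ?_
  · rw [← hr]
    exact alphaAt_le_bourgainRank f p hε
  · exact Order.add_one_le_of_lt (lt_alphaAt hf hε (h.elim (·.nonempty) (·.nonempty)))

theorem twoSided_iff {f : Cantor → ℝ} (hf : IsBaireOne f) {ν : Ordinal.{0}}
    (hr : bourgainRank f = ν + 1) :
    TwoSided f ↔ ∃ p ε : ℚ, 0 < ε ∧ ForcesYes f p ε ν ∧ ForcesNo f p ε ν := by
  constructor
  · rintro ⟨μ, hμ, p, ε, hmax, h1, h2⟩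
    obtain rfl : μ = ν := by simpa [hr] using hμ.symm
    exact ⟨p, ε, hmax.1, not_image_subset_Ioi_iff.1 h1, not_image_subset_Iio_iff.1 h2⟩
  · rintro ⟨p, ε, hε, h1, h2⟩
    exact ⟨ν, hr, p, ε, (isMaximalPair_iff hf hr).2 ⟨hε, Or.inl h1⟩,
      not_image_subset_Ioi_iff.2 h1, not_image_subset_Iio_iff.2 h2⟩

theorem leftSided_iff {f : Cantor → ℝ} (hf : IsBaireOne f) {ν : Ordinal.{0}}
    (hr : bourgainRank f = ν + 1) :
    LeftSided f ↔ ∀ p ε : ℚ, 0 < ε → ¬ ForcesNo f p ε ν := by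
  constructor
  · rintro ⟨μ, hμ, H⟩ p ε hε h
    obtain rfl : μ = ν := by simpa [hr] using hμ.symm
    exact not_image_subset_Iio_iff.2 h (H p ε ((isMaximalPair_iff hf hr).2 ⟨hε, Or.inr h⟩))
  · intro H
    refine ⟨ν, hr, fun p ε hmax => ?_⟩
    by_contra h
    exact H p ε hmax.1 (not_image_subset_Iio_iff.1 h)

theorem rightSided_iff {f : Cantor → ℝ} (hf : IsBaireOne f) {ν : Ordinal.{0}}
    (hr : bourgainRank f = ν + 1) :
    RightSided f ↔ ∀ p ε : ℚ, 0 < ε → ¬ ForcesYes f p ε ν := by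
  constructor
  · rintro ⟨μ, hμ, H⟩ p ε hε h
    obtain rfl : μ = ν := by simpa [hr] using hμ.symm
    exact not_image_subset_Ioi_iff.2 h (H p ε ((isMaximalPair_iff hf hr).2 ⟨hε, Or.inl h⟩))
  · intro H
    refine ⟨ν, hr, fun p ε hmax => ?_⟩
    by_contra h
    exact H p ε hmax.1 (not_image_subset_Ioi_iff.1 h)

theorem oneSided_iff {f : Cantor → ℝ} {ν : Ordinal.{0}} (hr : bourgainRank f = ν + 1) :
    OneSided f ↔ ¬ TwoSided f :=
  and_iff_right ⟨ν, hr⟩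

/-- A maximal pair always exists: shrinking the tolerance and moving `p` away from a value taken
on the last derivative keeps that derivative nonempty. -/
theorem exists_forces {f : Cantor → ℝ} {ν : Ordinal.{0}} (hr : bourgainRank f = ν + 1) :
    ∃ p ε : ℚ, 0 < ε ∧ (ForcesYes f p ε ν ∨ ForcesNo f p ε ν) := by
  obtain ⟨p, ε, hε, hlt⟩ := lt_bourgainRank_iff.1 (hr ▸ Order.lt_add_one_iff.2 le_rfl :
    ν < bourgainRank f)
  obtain ⟨x, hx⟩ := bourgainDeriv_nonempty_of_lt hlt
  have hεR : (0 : ℝ) < ε := by exact_mod_cast hε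
  rcases le_total (f x) p with h | h
  · refine ⟨p + ε / 2, ε / 2, half_pos hε, Or.inl ⟨x, bourgainDeriv_subset ?_ ?_ ν hx, ?_⟩⟩
    · intro y hy
      rw [mem_loSet] at hy ⊢
      push_cast
      linarith
    · intro y hy
      rw [mem_hiSet] at hy ⊢
      push_cast
      linarith
    · rw [mem_loSet]
      push_cast
      linarith
  · refine ⟨p - ε / 2, ε / 2, half_pos hε, Or.inr ⟨x, bourgainDeriv_subset ?_ ?_ ν hx, ?_⟩⟩
    · intro y hy
      rw [mem_loSet] at hy ⊢
      push_cast
      linarith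
    · intro y hy
      rw [mem_hiSet] at hy ⊢
      push_cast
      linarith
    · rw [mem_hiSet]
      push_cast
      linarith

theorem not_leftSided_and_rightSided {f : Cantor → ℝ} (hf : IsBaireOne f) {ν : Ordinal.{0}}
    (hr : bourgainRank f = ν + 1) : ¬ (LeftSided f ∧ RightSided f) := by
  rw [leftSided_iff hf hr, rightSided_iff hf hr]
  rintro ⟨hl, hr'⟩
  obtain ⟨p, ε, hε, h | h⟩ := exists_forces hr
  · exact hr' p ε hε h
  · exact hl p ε hε h

theorem LeftSided.not_twoSided {f : Cantor → ℝ} (hf : IsBaireOne f) (h : LeftSided f) :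
    ¬ TwoSided f := by
  obtain ⟨ν, hr, -⟩ := id h
  rw [leftSided_iff hf hr] at h
  rw [twoSided_iff hf hr]
  rintro ⟨p, ε, hε, -, h2⟩
  exact h p ε hε h2

theorem RightSided.not_twoSided {f : Cantor → ℝ} (hf : IsBaireOne f) (h : RightSided f) :
    ¬ TwoSided f := by
  obtain ⟨ν, hr, -⟩ := id h
  rw [rightSided_iff hf hr] at h
  rw [twoSided_iff hf hr]
  rintro ⟨p, ε, hε, h1, -⟩
  exact h p ε hε h1

/-! ### Reducibility in terms of rank and sidedness -/

/-- If every single question about `f` lasts strictly less long than some question about `g`, then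
`f` reduces to `g`. -/
theorem mReducible_of_forall_alphaAt_lt {f g : Cantor → ℝ} (hf : IsBaireOne f)
    (h : ∀ p ε : ℚ, 0 < ε → alphaAt f p ε < bourgainRank g) : MReducible f g := by
  rw [mReducible_iff]
  intro p ε hε
  obtain ⟨q, δ, hδ, hlt⟩ := lt_bourgainRank_iff.1 (h p ε hε)
  exact ⟨q, δ, hδ, .of_eq_empty (bourgainDeriv_alphaAt hf p hε) (bourgainDeriv_nonempty_of_lt hlt)⟩

theorem mReducible_of_bourgainRank_lt {f g : Cantor → ℝ} (hf : IsBaireOne f)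
    (h : bourgainRank f < bourgainRank g) : MReducible f g :=
  mReducible_of_forall_alphaAt_lt hf fun p _ hε => (alphaAt_le_bourgainRank f p hε).trans_lt h

theorem mReducible_of_isSuccLimit {f g : Cantor → ℝ} (hf : IsBaireOne f)
    (h : bourgainRank f = bourgainRank g) (hl : Order.IsSuccLimit (bourgainRank f)) :
    MReducible f g := by
  refine mReducible_of_forall_alphaAt_lt hf fun p ε hε => ?_
  rw [← h]
  refine lt_of_le_of_ne (alphaAt_le_bourgainRank f p hε) fun heq => ?_
  exact not_isSuccLimit_alphaAt hf hε (heq ▸ hl)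

theorem bourgainRank_le_of_mReducible {f g : Cantor → ℝ} (hg : IsBaireOne g)
    (h : MReducible f g) : bourgainRank f ≤ bourgainRank g := by
  refine bourgainRank_le fun p ε hε => ?_
  obtain ⟨q, δ, hδ, hk⟩ := mReducible_iff.1 h p ε hε
  by_contra hne
  exact ((hk.nonempty_imp _).1 (Set.nonempty_iff_ne_empty.2 hne)).ne_empty
    (bourgainDeriv_bourgainRank hg q hδ)

theorem bourgainRank_ne_zero {f : Cantor → ℝ} (hf : IsBaireOne f) : bourgainRank f ≠ 0 := by
  intro h
  have := bourgainDeriv_bourgainRank hf 0 one_pos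
  rw [h, bourgainDeriv_zero] at this
  exact Set.univ_nonempty.ne_empty this

/-- Reducibility between functions of the same successor rank compares the answers that are forced
at the last stage. -/
theorem mReducible_iff_of_add_one {f g : Cantor → ℝ} (hf : IsBaireOne f) (hg : IsBaireOne g)
    {ν : Ordinal.{0}} (hfr : bourgainRank f = ν + 1) (hgr : bourgainRank g = ν + 1) :
    MReducible f g ↔ TwoSided g ∨ (OneSided f ∧ ¬ RightSided g ∧ ¬ LeftSided g) ∨
      ((RightSided f ∧ RightSided g) ∨ (LeftSided f ∧ LeftSided g)) := by
  have hempty : ∀ p ε : ℚ, 0 < ε → bourgainDeriv f p ε (ν + 1) = ∅ := fun p ε hε =>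
    hfr ▸ bourgainDeriv_bourgainRank hf p hε
  rw [oneSided_iff hfr, twoSided_iff hf hfr, twoSided_iff hg hgr, leftSided_iff hf hfr,
    leftSided_iff hg hgr, rightSided_iff hf hfr, rightSided_iff hg hgr]
  constructor
  · intro h
    rw [mReducible_iff] at h
    by_cases h2 : ∃ p ε : ℚ, 0 < ε ∧ ForcesYes g p ε ν ∧ ForcesNo g p ε ν
    · exact Or.inl h2
    refine Or.inr ?_
    by_cases hR : ∀ p ε : ℚ, 0 < ε → ¬ ForcesYes g p ε ν
    · refine Or.inr (Or.inl ⟨fun p ε hε hy => ?_, hR⟩)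
      obtain ⟨q, δ, hδ, hk⟩ := h p ε hε
      exact hR q δ hδ ((hk.nonempty_imp ν).2.1 hy)
    by_cases hL : ∀ p ε : ℚ, 0 < ε → ¬ ForcesNo g p ε ν
    · refine Or.inr (Or.inr ⟨fun p ε hε hy => ?_, hL⟩)
      obtain ⟨q, δ, hδ, hk⟩ := h p ε hε
      exact hL q δ hδ ((hk.nonempty_imp ν).2.2 hy)
    refine Or.inl ⟨?_, hR, hL⟩
    rintro ⟨p, ε, hε, hy, hn⟩
    obtain ⟨q, δ, hδ, hk⟩ := h p ε hε
    exact h2 ⟨q, δ, hδ, (hk.nonempty_imp ν).2.1 hy, (hk.nonempty_imp ν).2.2 hn⟩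
  · -- a question about `f` that forces at most "yes" (at most "no") at the last stage reduces to
    -- any question about `g` that forces "yes" ("no") there
    have hyes : ∀ p ε q δ : ℚ, ForcesYes g q δ ν → ¬ ForcesNo f p ε ν →
        ReducesOn f p ε g q δ Set.univ Set.univ := fun p ε q δ ⟨y, hy, hlo⟩ hn =>
      .of_point hy (fun _ => hlo) (fun h => absurd h hn)
    have hno : ∀ p ε q δ : ℚ, ForcesNo g q δ ν → ¬ ForcesYes f p ε ν →
        ReducesOn f p ε g q δ Set.univ Set.univ := fun p ε q δ ⟨y, hy, hhi⟩ hn =>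
      .of_point hy (fun h => absurd h hn) (fun _ => hhi)
    rw [mReducible_iff]
    rintro (⟨q, δ, hδ, hlo, hhi⟩ | ⟨h1, hR, hL⟩ | ⟨hfR, hgR⟩ | ⟨hfL, hgL⟩) p ε hε
    · exact ⟨q, δ, hδ, .of_two_points (hempty p ε hε) hlo hhi⟩
    · push Not at hR hL
      by_cases hy : ForcesYes f p ε ν
      · obtain ⟨q, δ, hδ, hg'⟩ := hR
        exact ⟨q, δ, hδ, hyes p ε q δ hg' fun hn => h1 ⟨p, ε, hε, hy, hn⟩⟩
      · obtain ⟨q, δ, hδ, hg'⟩ := hL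
        exact ⟨q, δ, hδ, hno p ε q δ hg' hy⟩
    · obtain ⟨q, δ, hδ, hg' | hg'⟩ := exists_forces hgr
      · exact absurd hg' (hgR q δ hδ)
      · exact ⟨q, δ, hδ, hno p ε q δ hg' (hfR p ε hε)⟩
    · obtain ⟨q, δ, hδ, hg' | hg'⟩ := exists_forces hgr
      · exact ⟨q, δ, hδ, hyes p ε q δ hg' (hfL p ε hε)⟩
      · exact absurd hg' (hgL q δ hδ)

theorem mReducible_iff_of_bourgainRank_eq {f g : Cantor → ℝ} (hf : IsBaireOne f)
    (hg : IsBaireOne g) (h : bourgainRank f = bourgainRank g) :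
    MReducible f g ↔
      Order.IsSuccLimit (bourgainRank f) ∨
      TwoSided g ∨
      (OneSided f ∧ ¬ RightSided g ∧ ¬ LeftSided g) ∨
      ((RightSided f ∧ RightSided g) ∨ (LeftSided f ∧ LeftSided g)) := by
  rcases Ordinal.zero_or_succ_or_isSuccLimit (bourgainRank f) with h0 | ⟨ν, hν⟩ | hl
  · exact absurd h0 (bourgainRank_ne_zero hf)
  · have hl : ¬ Order.IsSuccLimit (bourgainRank f) := hν ▸ Order.not_isSuccLimit_succ ν
    rw [mReducible_iff_of_add_one hf hg hν.symm (h ▸ hν.symm), or_iff_right hl]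
  · exact iff_of_true (mReducible_of_isSuccLimit hf h hl) (Or.inl hl)

/-! ### Baire 1 functions are closed under reducibility -/

theorem Continuous.isBaireOne {f : Cantor → ℝ} (hf : Continuous f) : IsBaireOne f :=
  ⟨fun _ => f, fun _ => hf, fun _ => tendsto_const_nhds⟩

theorem IsBaireOne.add {f g : Cantor → ℝ} (hf : IsBaireOne f) (hg : IsBaireOne g) :
    IsBaireOne (fun x => f x + g x) := by
  obtain ⟨F, hF, hFl⟩ := hf
  obtain ⟨G, hG, hGl⟩ := hg
  exact ⟨fun n x => F n x + G n x, fun n => (hF n).add (hG n), fun x => (hFl x).add (hGl x)⟩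

theorem IsBaireOne.continuous_comp {f : Cantor → ℝ} {φ : ℝ → ℝ} (hφ : Continuous φ)
    (hf : IsBaireOne f) : IsBaireOne (fun x => φ (f x)) := by
  obtain ⟨F, hF, hFl⟩ := hf
  exact ⟨fun n x => φ (F n x), fun n => hφ.comp (hF n), fun x => (hφ.tendsto _).comp (hFl x)⟩

theorem IsBaireOne.comp_continuous {f : Cantor → ℝ} {k : Cantor → Cantor} (hf : IsBaireOne f)
    (hk : Continuous k) : IsBaireOne (fun x => f (k x)) := by
  obtain ⟨F, hF, hFl⟩ := hf
  exact ⟨fun n x => F n (k x), fun n => (hF n).comp hk, fun x => hFl (k x)⟩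

theorem IsBaireOne.sum_range {f : ℕ → Cantor → ℝ} (hf : ∀ i, IsBaireOne (f i)) (n : ℕ) :
    IsBaireOne (fun x => ∑ i ∈ Finset.range n, f i x) := by
  induction n with
  | zero => simpa using (continuous_const (y := (0 : ℝ))).isBaireOne
  | succ n ih => simpa only [Finset.sum_range_succ] using ih.add (hf n)

/-- A uniform limit of Baire 1 functions is Baire 1: write it as a series of Baire 1 functions with
summable bounds, and truncate the continuous approximations of the terms at these bounds. -/
theorem isBaireOne_of_forall_approx {f : Cantor → ℝ}
    (H : ∀ η : ℝ, 0 < η → ∃ u, IsBaireOne u ∧ ∀ x, |f x - u x| ≤ η) : IsBaireOne f := by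
  choose u hu hfu using fun n : ℕ => H ((1 / 2) ^ n) (by positivity)
  have hd : ∀ n, IsBaireOne (fun x => u (n + 1) x + -u n x) := fun n => (hu (n + 1)).add (hu n).neg
  obtain ⟨U, hU, hUl⟩ := hu 0
  choose G hG hGl using hd
  let b : ℕ → ℝ := fun n => 2 * (1 / 2) ^ n
  have hb0 : ∀ n, 0 ≤ b n := fun n => by positivity
  have hb : Summable b := summable_geometric_two.mul_left 2
  have hdb : ∀ n x, |u (n + 1) x + -u n x| ≤ b n := fun n x => by
    have h1 := abs_le.1 (hfu n x)
    have h2 := abs_le.1 (hfu (n + 1) x)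
    have h3 : ((1 : ℝ) / 2) ^ (n + 1) ≤ (1 / 2) ^ n :=
      pow_le_pow_of_le_one (by norm_num) (by norm_num) n.le_succ
    rw [abs_le]
    constructor <;> linarith
  let C : ℕ → ℝ → ℝ := fun n t => max (-b n) (min (b n) t)
  have hC : ∀ n, Continuous (C n) := fun n =>
    continuous_const.max (continuous_const.min continuous_id)
  have hCb : ∀ n t, ‖C n t‖ ≤ b n := fun n t =>
    abs_le.2 ⟨le_max_left _ _, max_le (by linarith [hb0 n]) (min_le_left _ _)⟩
  have hCd : ∀ n x, C n (u (n + 1) x + -u n x) = u (n + 1) x + -u n x := fun n x => by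
    have := abs_le.1 (hdb n x)
    rw [show C n _ = max (-b n) (min (b n) _) from rfl, min_eq_right this.2, max_eq_right this.1]
  refine ⟨fun m x => U m x + ∑' n, C n (G n m x), fun m => (hU m).add
    (continuous_tsum (fun n => (hC n).comp (hG n m)) hb fun n x => hCb n _), fun x => ?_⟩
  have hsum : Summable fun n => u (n + 1) x + -u n x :=
    Summable.of_norm_bounded hb fun n => hdb n x
  have hux : Tendsto (fun n => u n x) atTop (𝓝 (f x)) := by
    have h0 : Tendsto (fun n : ℕ => ((1 : ℝ) / 2) ^ n) atTop (𝓝 0) :=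
      tendsto_pow_atTop_nhds_zero_of_lt_one (by norm_num) (by norm_num)
    rw [tendsto_iff_dist_tendsto_zero]
    refine squeeze_zero (fun n => dist_nonneg) (fun n => ?_) h0
    rw [Real.dist_eq, abs_sub_comm]
    exact hfu n x
  have htsum : ∑' n, (u (n + 1) x + -u n x) = f x - u 0 x := by
    refine tendsto_nhds_unique hsum.hasSum.tendsto_sum_nat ?_
    simp only [← sub_eq_add_neg, Finset.sum_range_sub (fun n => u n x)]
    exact hux.sub tendsto_const_nhds
  have hlim : Tendsto (fun m => ∑' n, C n (G n m x)) atTop (𝓝 (f x - u 0 x)) := by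
    rw [← htsum]
    refine tendsto_tsum_of_dominated_convergence hb (fun n => ?_)
      (Eventually.of_forall fun m n => hCb n _)
    have := ((hC n).tendsto _).comp (hGl n x)
    rwa [hCd] at this
  simpa using (hUl x).add hlim

/-- For all real `a < b`, the sets `{f ≤ a}` and `{b ≤ f}` are separated by a Baire 1 function
with values in `[0, 1]`. -/
def BaireSeparated (f : Cantor → ℝ) : Prop :=
  ∀ a b : ℝ, a < b → ∃ χ : Cantor → ℝ, IsBaireOne χ ∧
    ∀ x, χ x ∈ Set.Icc (0 : ℝ) 1 ∧ (f x ≤ a → χ x = 0) ∧ (b ≤ f x → χ x = 1)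

/-- A bounded function is uniformly approximated by the sums of the separating functions along a
fine partition of its range. -/
theorem BaireSeparated.isBaireOne_of_bounded {f : Cantor → ℝ} (h : BaireSeparated f) {c d : ℝ}
    (hcd : ∀ x, f x ∈ Set.Icc c d) : IsBaireOne f := by
  refine isBaireOne_of_forall_approx fun η hη => ?_
  choose χ hχ Hχ using fun i : ℕ => h (c + i * η) (c + (i + 1) * η) (by linarith)
  have key : ∀ (n : ℕ) (x : Cantor),
      (f x ≤ c + n * η → |f x - (c + ∑ i ∈ Finset.range n, η * χ i x)| ≤ η) ∧
      (c + n * η ≤ f x → ∑ i ∈ Finset.range n, η * χ i x = n * η) := by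
    intro n x
    have hc := (hcd x).1
    induction n with
    | zero =>
      simp only [Nat.cast_zero, zero_mul, add_zero, Finset.range_zero, Finset.sum_empty,
        implies_true, and_true]
      intro hx
      rw [le_antisymm hx hc, sub_self, abs_zero]
      exact hη.le
    | succ n ih =>
      obtain ⟨⟨h0, h1⟩, hlo, hhi⟩ := Hχ n x
      have h0' : 0 ≤ η * χ n x := mul_nonneg hη.le h0
      have h1' : η * χ n x ≤ η := mul_le_of_le_one_right hη.le h1
      rw [Finset.sum_range_succ]
      push_cast
      refine ⟨fun hx => ?_, fun hx => ?_⟩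
      · rcases le_total (f x) (c + n * η) with hx' | hx'
        · rw [hlo hx', mul_zero, add_zero]
          exact ih.1 hx'
        · rw [ih.2 hx', abs_le]
          constructor <;> linarith
      · rw [ih.2 (by linarith), hhi hx]
        ring
  obtain ⟨n, hn⟩ := exists_nat_ge ((d - c) / η)
  rw [div_le_iff₀ hη] at hn
  refine ⟨fun x => c + ∑ i ∈ Finset.range n, η * χ i x,
    (continuous_const (y := c)).isBaireOne.add
      (.sum_range (fun i => (hχ i).continuous_comp (continuous_const_mul η)) n),
    fun x => (key n x).1 ?_⟩
  linarith [(hcd x).2]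

theorem BaireSeparated.arctan {f : Cantor → ℝ} (h : BaireSeparated f) :
    BaireSeparated (fun x => Real.arctan (f x)) := by
  intro a b hab
  by_cases ha : ∃ x, Real.arctan (f x) ≤ a
  swap
  · exact ⟨fun _ => 1, continuous_const.isBaireOne, fun x =>
      ⟨⟨zero_le_one, le_rfl⟩, fun hx => absurd ⟨x, hx⟩ ha, fun _ => rfl⟩⟩
  by_cases hb : ∃ x, b ≤ Real.arctan (f x)
  swap
  · exact ⟨fun _ => 0, continuous_const.isBaireOne, fun x =>
      ⟨⟨le_rfl, zero_le_one⟩, fun _ => rfl, fun hx => absurd ⟨x, hx⟩ hb⟩⟩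
  obtain ⟨x₀, hx₀⟩ := ha
  obtain ⟨x₁, hx₁⟩ := hb
  have ha' : -(Real.pi / 2) < a := (Real.neg_pi_div_two_lt_arctan _).trans_le hx₀
  have hb' : b < Real.pi / 2 := hx₁.trans_lt (Real.arctan_lt_pi_div_two _)
  have hta : Real.arctan (Real.tan a) = a := Real.arctan_tan ha' (hab.trans hb')
  have htb : Real.arctan (Real.tan b) = b := Real.arctan_tan (ha'.trans hab) hb'
  obtain ⟨χ, hχ, H⟩ := h (Real.tan a) (Real.tan b)
    (Real.arctan_strictMono.lt_iff_lt.1 (by rwa [hta, htb]))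
  refine ⟨χ, hχ, fun x => ⟨(H x).1, fun hx => (H x).2.1 ?_, fun hx => (H x).2.2 ?_⟩⟩
  · exact Real.arctan_strictMono.le_iff_le.1 (by rwa [hta])
  · exact Real.arctan_strictMono.le_iff_le.1 (by rwa [htb])

theorem BaireSeparated.isBaireOne {f : Cantor → ℝ} (h : BaireSeparated f) : IsBaireOne f := by
  obtain ⟨F, hF, hFl⟩ := h.arctan.isBaireOne_of_bounded
    (fun x => ⟨(Real.neg_pi_div_two_lt_arctan _).le, (Real.arctan_lt_pi_div_two _).le⟩)
  -- the approximations may leave the domain of `tan`, so its denominator is kept positive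
  have hpos : ∀ n : ℕ, (0 : ℝ) < 1 / ((n : ℝ) + 1) := fun n => by positivity
  refine ⟨fun n x => Real.sin (F n x) / max (Real.cos (F n x)) (1 / ((n : ℝ) + 1)), fun n => ?_,
    fun x => ?_⟩
  · exact (Real.continuous_sin.comp (hF n)).div
      ((Real.continuous_cos.comp (hF n)).max continuous_const)
      fun x => ((hpos n).trans_le (le_max_right _ _)).ne'
  · have hc := Real.cos_arctan_pos (f x)
    have h1 := ((Real.continuous_cos.tendsto _).comp (hFl x)).max
      (tendsto_one_div_add_atTop_nhds_zero_nat (𝕜 := ℝ))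
    rw [max_eq_left hc.le] at h1
    have h2 := ((Real.continuous_sin.tendsto _).comp (hFl x)).div h1 hc.ne'
    rw [← Real.tan_eq_sin_div_cos, Real.tan_arctan] at h2
    exact h2

/-- A reduction to a Baire 1 function `g` separates the forced sets of `f` by a truncation of
`g ∘ k`. -/
theorem IsBaireOne.of_mReducible {f g : Cantor → ℝ} (hg : IsBaireOne g) (h : MReducible f g) :
    IsBaireOne f := by
  refine BaireSeparated.isBaireOne fun a b hab => ?_
  obtain ⟨r, har, hrb⟩ := exists_rat_btwn hab
  obtain ⟨s, hrs, hsb⟩ := exists_rat_btwn hrb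
  have hrs' : r < s := by exact_mod_cast hrs
  obtain ⟨q, δ, hδ, k, hk, H⟩ := mReducible_iff.1 h ((r + s) / 2) ((s - r) / 2) (by linarith)
  have hδR : (0 : ℝ) < δ := by exact_mod_cast hδ
  let φ : ℝ → ℝ := fun t => max 0 (min 1 ((t - (q - δ)) / (2 * δ)))
  have hφ : Continuous φ := by fun_prop
  refine ⟨fun x => φ (g (k x)), (hg.comp_continuous (continuousOn_univ.1 hk)).continuous_comp hφ,
    fun x => ⟨⟨le_max_left _ _, max_le zero_le_one (min_le_left _ _)⟩, fun hx => ?_, fun hx => ?_⟩⟩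
  · have h1 := mem_loSet.1 ((H x trivial).2.1 (by rw [mem_loSet]; push_cast; linarith))
    refine max_eq_left ((min_le_right _ _).trans ?_)
    exact div_nonpos_of_nonpos_of_nonneg (by linarith) (by linarith)
  · have h1 := mem_hiSet.1 ((H x trivial).2.2 (by rw [mem_hiSet]; push_cast; linarith))
    have h2 : 1 ≤ (g (k x) - (q - δ)) / (2 * δ) := by
      rw [le_div_iff₀ (by linarith)]
      linarith
    change max 0 (min 1 _) = (1 : ℝ)
    rw [min_eq_left h2, max_eq_right zero_le_one]

/-! ### Gluing a sequence of functions at a point -/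

/-- The point `000…` of Cantor space. -/
def zeroSeq : Cantor := fun _ => false

/-- The sequence `0ⁿ1x`. -/
def zerosOne (n : ℕ) (x : Cantor) : Cantor :=
  fun i => if i < n then false else if i = n then true else x (i - (n + 1))

theorem zerosOne_of_lt {n i : ℕ} (h : i < n) (x : Cantor) : zerosOne n x i = false := if_pos h

theorem zerosOne_self (n : ℕ) (x : Cantor) : zerosOne n x n = true := by simp [zerosOne]

theorem zerosOne_add (n i : ℕ) (x : Cantor) : zerosOne n x (i + (n + 1)) = x i := by
  simp only [zerosOne]
  rw [if_neg (by omega), if_neg (by omega), Nat.add_sub_cancel]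

theorem find_zerosOne {n : ℕ} {x : Cantor} (h : ∃ i, zerosOne n x i = true) :
    Nat.find h = n := by
  rw [Nat.find_eq_iff]
  exact ⟨zerosOne_self n x, fun m hm => by simp [zerosOne_of_lt hm]⟩

theorem zerosOne_find {x : Cantor} (h : ∃ i, x i = true) :
    zerosOne (Nat.find h) (fun i => x (i + (Nat.find h + 1))) = x := by
  funext i
  rcases lt_trichotomy i (Nat.find h) with hi | rfl | hi
  · rw [zerosOne_of_lt hi]
    simpa using (Nat.find_min h hi)
  · rw [zerosOne_self]
    exact (Nat.find_spec h).symm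
  · obtain ⟨j, rfl⟩ := Nat.exists_eq_add_of_le' (Nat.succ_le_of_lt hi)
    exact zerosOne_add _ _ _

theorem eq_zeroSeq_or_exists_eq_zerosOne (x : Cantor) :
    x = zeroSeq ∨ ∃ n y, x = zerosOne n y := by
  by_cases h : ∃ i, x i = true
  · exact Or.inr ⟨_, _, (zerosOne_find h).symm⟩
  · refine Or.inl (funext fun i => ?_)
    simpa [zeroSeq] using not_exists.1 h i

theorem zerosOne_mem_cylinder {n m : ℕ} (h : m ≤ n) (x : Cantor) :
    zerosOne n x ∈ PiNat.cylinder zeroSeq m :=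
  fun _ hi => zerosOne_of_lt (hi.trans_le h) x

theorem isOpenEmbedding_zerosOne (n : ℕ) : IsOpenEmbedding (zerosOne n) := by
  have hc : Continuous (zerosOne n) := by
    refine continuous_pi fun i => ?_
    simp only [zerosOne]
    split_ifs
    · exact continuous_const
    · exact continuous_const
    · exact continuous_apply _
  have hl : Function.LeftInverse (fun (x : Cantor) i => x (i + (n + 1))) (zerosOne n) :=
    fun x => funext fun i => zerosOne_add n i x
  have hlc : Continuous (fun (x : Cantor) (i : ℕ) => x (i + (n + 1))) :=
    continuous_pi fun i => continuous_apply _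
  refine ⟨hl.isEmbedding hlc hc, ?_⟩
  refine (isClopen_of_forall_mem_cylinder (n + 1) ?_).isOpen
  rintro _ ⟨x, rfl⟩ z hz
  rw [PiNat.mem_cylinder_iff] at hz
  have hzn : z n = true := by rw [hz n n.lt_succ_self, zerosOne_self]
  have hzl : ∀ m < n, ¬ z m = true := fun m hm => by
    rw [hz m (hm.trans n.lt_succ_self), zerosOne_of_lt hm]
    simp
  have hex : ∃ i, z i = true := ⟨n, hzn⟩
  have hfind : Nat.find hex = n := (Nat.find_eq_iff hex).2 ⟨hzn, hzl⟩
  have := zerosOne_find hex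
  rw [hfind] at this
  exact ⟨_, this⟩

/-- The function with value `c` at `000…` and value `F n x` at `0ⁿ1x`. -/
noncomputable def glue (c : ℝ) (F : ℕ → Cantor → ℝ) : Cantor → ℝ := fun x =>
  open scoped Classical in
  if h : ∃ i, x i = true then F (Nat.find h) (fun i => x (i + (Nat.find h + 1))) else c

section glue

variable {c : ℝ} {F : ℕ → Cantor → ℝ} {p ε : ℚ} {ν : Ordinal.{0}}

theorem glue_zeroSeq (c : ℝ) (F : ℕ → Cantor → ℝ) : glue c F zeroSeq = c :=
  dif_neg (by simp [zeroSeq])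

theorem glue_zerosOne (c : ℝ) (F : ℕ → Cantor → ℝ) (n : ℕ) (x : Cantor) :
    glue c F (zerosOne n x) = F n x := by
  have h : ∃ i, zerosOne n x i = true := ⟨n, zerosOne_self n x⟩
  rw [glue, dif_pos h]
  have : ∀ m, m = n → F m (fun i => zerosOne n x (i + (m + 1))) = F n x := by
    rintro m rfl
    exact congrArg (F m) (funext fun i => zerosOne_add m i x)
  exact this _ (by convert find_zerosOne h)

theorem continuousAt_glue_zeroSeq (h : ∀ V ∈ 𝓝 c, ∃ N, ∀ n ≥ N, ∀ x, F n x ∈ V) :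
    ContinuousAt (glue c F) zeroSeq := by
  rw [ContinuousAt, glue_zeroSeq]
  intro V hV
  obtain ⟨N, hN⟩ := h V hV
  rw [mem_map]
  filter_upwards [cylinder_mem_nhds zeroSeq N] with z hz
  rcases eq_zeroSeq_or_exists_eq_zerosOne z with rfl | ⟨n, y, rfl⟩
  · rw [Set.mem_preimage, glue_zeroSeq]
    exact mem_of_mem_nhds hV
  · rw [Set.mem_preimage, glue_zerosOne]
    refine hN n ?_ y
    by_contra! hlt
    have := PiNat.mem_cylinder_iff.1 hz n hlt
    rw [zerosOne_self] at this
    exact Bool.noConfusion this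

theorem continuous_glue (hF : ∀ n, Continuous (F n))
    (h : ∀ V ∈ 𝓝 c, ∃ N, ∀ n ≥ N, ∀ x, F n x ∈ V) : Continuous (glue c F) := by
  refine continuous_iff_continuousAt.2 fun x => ?_
  rcases eq_zeroSeq_or_exists_eq_zerosOne x with rfl | ⟨n, y, rfl⟩
  · exact continuousAt_glue_zeroSeq h
  · rw [← (isOpenEmbedding_zerosOne n).continuousAt_iff]
    have : glue c F ∘ zerosOne n = F n := funext fun y => glue_zerosOne c F n y
    rw [this]
    exact (hF n).continuousAt

theorem IsBaireOne.glue (hF : ∀ n, IsBaireOne (F n)) (c : ℝ) : IsBaireOne (glue c F) := by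
  choose G hG hGl using hF
  refine ⟨fun m => _root_.glue c (fun n x => if n < m then G n m x else c), fun m => ?_,
    fun x => ?_⟩
  · refine continuous_glue (fun n => ?_) fun V hV => ⟨m, fun n hn x => ?_⟩
    · split_ifs
      · exact hG n m
      · exact continuous_const
    · rw [if_neg (not_lt.2 hn)]
      exact mem_of_mem_nhds hV
  · rcases eq_zeroSeq_or_exists_eq_zerosOne x with rfl | ⟨n, y, rfl⟩
    · simp only [glue_zeroSeq]
      exact tendsto_const_nhds
    · simp only [glue_zerosOne]
      refine (hGl n y).congr' ?_
      filter_upwards [eventually_gt_atTop n] with m hm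
      rw [if_pos hm]

theorem zerosOne_mem_bourgainDeriv_glue {n : ℕ} {y : Cantor} :
    zerosOne n y ∈ bourgainDeriv (glue c F) p ε ν ↔ y ∈ bourgainDeriv (F n) p ε ν := by
  rw [← Set.mem_preimage, preimage_bourgainDeriv (isOpenEmbedding_zerosOne n).continuous
    (isOpenEmbedding_zerosOne n).isOpenMap]
  have : glue c F ∘ zerosOne n = F n := funext fun y => glue_zerosOne c F n y
  rw [this]

/-- Points of continuity are removed in the first step. -/
theorem notMem_bourgainDeriv_of_continuousAt {f : Cantor → ℝ} {x : Cantor}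
    (hf : ContinuousAt f x) (hε : 0 < ε) (hν : 1 ≤ ν) : x ∉ bourgainDeriv f p ε ν := by
  intro hx
  have h1 := bourgainDeriv_antitone f p ε hν hx
  rw [← zero_add 1, bourgainDeriv_add_one] at h1
  have hεR : (0 : ℝ) < ε := by exact_mod_cast hε
  have hlo : f x ≤ (p : ℝ) - ε := by
    by_contra! hlt
    obtain ⟨y, hy, -, hy'⟩ := mem_closure_iff_nhds.1 h1.1 _ (hf.eventually_const_lt hlt)
    exact (not_lt.2 (mem_loSet.1 hy')) hy
  have hhi : (p : ℝ) + ε ≤ f x := by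
    by_contra! hlt
    obtain ⟨y, hy, -, hy'⟩ := mem_closure_iff_nhds.1 h1.2 _ (hf.eventually_lt_const hlt)
    exact (not_lt.2 (mem_hiSet.1 hy')) hy
  linarith

theorem bourgainDeriv_glue_eq_empty (h : ∀ V ∈ 𝓝 c, ∃ N, ∀ n ≥ N, ∀ x, F n x ∈ V)
    (hε : 0 < ε) (hν : 1 ≤ ν) (hF : ∀ n, bourgainDeriv (F n) p ε ν = ∅) :
    bourgainDeriv (glue c F) p ε ν = ∅ := by
  refine Set.eq_empty_of_forall_notMem fun x hx => ?_
  rcases eq_zeroSeq_or_exists_eq_zerosOne x with rfl | ⟨n, y, rfl⟩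
  · exact notMem_bourgainDeriv_of_continuousAt (continuousAt_glue_zeroSeq h) hε hν hx
  · rw [zerosOne_mem_bourgainDeriv_glue, hF n] at hx
    exact hx

end glue

/-! ### Functions of every rank -/

section models

variable {p ε : ℚ} {ν : Ordinal.{0}}

theorem bourgainRank_eq_add_one {f : Cantor → ℝ} (hf : IsBaireOne f)
    (hempty : ∀ p ε : ℚ, 0 < ε → bourgainDeriv f p ε (ν + 1) = ∅) (hε : 0 < ε)
    (hne : (bourgainDeriv f p ε ν).Nonempty) : bourgainRank f = ν + 1 :=
  le_antisymm (bourgainRank_le hempty)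
    (Order.add_one_le_of_lt ((lt_alphaAt hf hε hne).trans_le (alphaAt_le_bourgainRank f p hε)))

theorem bourgainDeriv_affine (f : Cantor → ℝ) (p ε : ℚ) (ν : Ordinal.{0}) {a : ℚ} (ha : 0 < a)
    (c : ℚ) : bourgainDeriv (fun x => a * f x + c) p ε ν =
      bourgainDeriv f ((p - c) / a) (ε / a) ν := by
  have haR : (0 : ℝ) < a := by exact_mod_cast ha
  have hlo : loSet (fun x => a * f x + c) p ε = loSet f ((p - c) / a) (ε / a) := by
    ext x
    rw [mem_loSet, mem_loSet]
    push_cast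
    rw [← sub_div, le_div_iff₀ haR]
    constructor <;> intro h <;> linarith
  have hhi : hiSet (fun x => a * f x + c) p ε = hiSet f ((p - c) / a) (ε / a) := by
    ext x
    rw [mem_hiSet, mem_hiSet]
    push_cast
    rw [← add_div, div_le_iff₀ haR]
    constructor <;> intro h <;> linarith
  exact (bourgainDeriv_subset hlo.subset hhi.subset ν).antisymm
    (bourgainDeriv_subset hlo.symm.subset hhi.symm.subset ν)

theorem IsBaireOne.affine {f : Cantor → ℝ} (hf : IsBaireOne f) (a c : ℚ) :
    IsBaireOne (fun x => a * f x + c) :=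
  hf.continuous_comp (φ := fun t => a * t + c) (by fun_prop)

/-- A Baire 1 function with values `0` and `1` whose `ν`-th derivative for the question
`(1/2, 1/2)` is nonempty; on this derivative the function is constant, with value `1` if `b` is
`true` and value `0` if `b` is `false`. -/
structure IsModel (ν : Ordinal.{0}) (b : Bool) (f : Cantor → ℝ) : Prop where
  isBaireOne : IsBaireOne f
  zero_or_one : ∀ x, f x = 0 ∨ f x = 1
  nonempty : (bourgainDeriv f (1 / 2) (1 / 2) ν).Nonempty
  eq_cond : ∀ x ∈ bourgainDeriv f (1 / 2) (1 / 2) ν, f x = cond b 1 0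

theorem IsModel.deriv_add_one_eq_empty {b : Bool} {f : Cantor → ℝ} (h : IsModel ν b f) :
    bourgainDeriv f (1 / 2) (1 / 2) (ν + 1) = ∅ := by
  refine Set.eq_empty_of_forall_notMem fun x hx => ?_
  rw [bourgainDeriv_add_one] at hx
  cases b with
  | true =>
    obtain ⟨y, hy, hy'⟩ := closure_nonempty_iff.1 ⟨x, hx.1⟩
    have := h.eq_cond y hy
    rw [mem_loSet, this] at hy'
    norm_num at hy'
  | false =>
    obtain ⟨y, hy, hy'⟩ := closure_nonempty_iff.1 ⟨x, hx.2⟩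
    have := h.eq_cond y hy
    rw [mem_hiSet, this] at hy'
    norm_num at hy'

/-- For a function with values `0` and `1`, only the questions between `0` and `1` survive the
first step, and these amount to the question `(1/2, 1/2)`. -/
theorem IsModel.of_mem {b : Bool} {f : Cantor → ℝ} {μ : Ordinal.{0}} (h : IsModel ν b f)
    (hμ : 1 ≤ μ) {x : Cantor} (hε : 0 < ε) (hx : x ∈ bourgainDeriv f p ε μ) :
    x ∈ bourgainDeriv f (1 / 2) (1 / 2) μ ∧ (0 : ℝ) ≤ p - ε ∧ (p : ℝ) + ε ≤ 1 := by
  have hεR : (0 : ℝ) < ε := by exact_mod_cast hε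
  have h1 := bourgainDeriv_antitone f p ε hμ hx
  rw [← zero_add 1, bourgainDeriv_add_one] at h1
  obtain ⟨y, -, hy⟩ := closure_nonempty_iff.1 ⟨x, h1.1⟩
  obtain ⟨z, -, hz⟩ := closure_nonempty_iff.1 ⟨x, h1.2⟩
  rw [mem_loSet] at hy
  rw [mem_hiSet] at hz
  have hp : (0 : ℝ) ≤ p - ε := by rcases h.zero_or_one y with h | h <;> linarith
  have hp' : (p : ℝ) + ε ≤ 1 := by rcases h.zero_or_one z with h | h <;> linarith
  refine ⟨bourgainDeriv_subset (fun w hw => ?_) (fun w hw => ?_) μ hx, hp, hp'⟩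
  · rw [mem_loSet] at hw ⊢
    push_cast
    rcases h.zero_or_one w with h | h <;> linarith
  · rw [mem_hiSet] at hw ⊢
    push_cast
    rcases h.zero_or_one w with h | h <;> linarith

theorem IsModel.eq_empty {b : Bool} {f : Cantor → ℝ} {μ : Ordinal.{0}} (h : IsModel ν b f)
    (hμ : ν < μ) (p : ℚ) (hε : 0 < ε) : bourgainDeriv f p ε μ = ∅ := by
  refine Set.eq_empty_of_forall_notMem fun x hx => ?_
  have hμ1 : 1 ≤ μ := Order.one_le_iff_pos.2 (hμ.trans_le' (zero_le))
  have := bourgainDeriv_antitone f _ _ (Order.add_one_le_of_lt hμ) (h.of_mem hμ1 hε hx).1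
  rw [h.deriv_add_one_eq_empty] at this
  exact this

theorem countable_Iio_of_lt_omega_one (hν : ν < ω₁) : Countable (Set.Iio ν) := by
  rw [← Cardinal.mk_le_aleph0_iff, Cardinal.mk_Iio_ordinal, Cardinal.lift_le_aleph0,
    ← Order.lt_succ_iff, Cardinal.succ_aleph0, ← Cardinal.lt_ord, Cardinal.ord_aleph]
  exact hν

/-- Models of smaller rank, each of them repeated infinitely often, are glued at a point, which
then survives exactly up to stage `ν`. -/
theorem exists_isModel (hν : ν < ω₁) (b : Bool) : ∃ f, IsModel ν b f := by
  induction ν using WellFoundedLT.induction generalizing b with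
  | ind ν ih =>
  have hcond : (cond b 1 0 : ℝ) = 0 ∨ (cond b 1 0 : ℝ) = 1 := by cases b <;> simp
  rcases eq_or_ne ν 0 with rfl | hν0
  · exact ⟨fun _ => cond b 1 0, continuous_const.isBaireOne, fun _ => hcond,
      by rw [bourgainDeriv_zero]; exact Set.univ_nonempty, fun _ _ => rfl⟩
  have := countable_Iio_of_lt_omega_one hν
  have : Nonempty (Set.Iio ν) := ⟨⟨0, Set.mem_Iio.2 (pos_iff_ne_zero.2 hν0)⟩⟩
  obtain ⟨s, hs⟩ := exists_surjective_nat (Set.Iio ν × Bool)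
  choose m hm using fun j : Set.Iio ν × Bool => ih j.1 j.1.2 (j.1.2.trans hν) j.2
  let F : ℕ → Cantor → ℝ := fun i => m (s i.unpair.1)
  have hF : ∀ i, IsModel (s i.unpair.1).1 (s i.unpair.1).2 (F i) := fun i => hm _
  have hmem : ∀ μ ≤ ν, zeroSeq ∈ bourgainDeriv (glue (cond b 1 0) F) (1 / 2) (1 / 2) μ := by
    intro μ
    induction μ using Ordinal.limitRecOn with
    | zero => simp [bourgainDeriv_zero]
    | add_one μ _ =>
      intro hμ
      have hlt : μ < ν := Order.add_one_le_iff.1 hμ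
      have key : ∀ b' : Bool, ∀ V ∈ 𝓝 zeroSeq, ∃ x ∈ V,
          x ∈ bourgainDeriv (glue (cond b 1 0) F) (1 / 2) (1 / 2) μ ∧
            glue (cond b 1 0) F x = cond b' 1 0 := by
        intro b' V hV
        obtain ⟨N, hN⟩ := exists_cylinder_subset hV
        obtain ⟨j, hj⟩ := hs (⟨μ, hlt⟩, b')
        -- the pieces with index `Nat.pair j N`, for varying `N`, all carry the same model
        have h := hF (Nat.pair j N)
        rw [Nat.unpair_pair, hj] at h
        obtain ⟨y, hy⟩ := h.nonempty
        refine ⟨zerosOne (Nat.pair j N) y, hN (zerosOne_mem_cylinder (Nat.right_le_pair j N) y),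
          zerosOne_mem_bourgainDeriv_glue.2 hy, ?_⟩
        rw [glue_zerosOne]
        exact h.eq_cond y hy
      rw [bourgainDeriv_add_one]
      constructor
      · refine mem_closure_iff_nhds.2 fun V hV => ?_
        obtain ⟨x, hxV, hx, hxv⟩ := key false V hV
        exact ⟨x, hxV, hx, by rw [mem_loSet, hxv]; norm_num⟩
      · refine mem_closure_iff_nhds.2 fun V hV => ?_
        obtain ⟨x, hxV, hx, hxv⟩ := key true V hV
        exact ⟨x, hxV, hx, by rw [mem_hiSet, hxv]; norm_num⟩
    | limit μ hμ ih' =>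
      intro hle
      rw [mem_bourgainDeriv_limit hμ]
      exact fun μ' hμ' => ih' μ' hμ' (hμ'.le.trans hle)
  refine ⟨glue (cond b 1 0) F, .glue (fun i => (hF i).isBaireOne) _, fun x => ?_,
    ⟨_, hmem ν le_rfl⟩, fun x hx => ?_⟩
  · rcases eq_zeroSeq_or_exists_eq_zerosOne x with rfl | ⟨n, y, rfl⟩
    · rw [glue_zeroSeq]
      exact hcond
    · rw [glue_zerosOne]
      exact (hF n).zero_or_one y
  · rcases eq_zeroSeq_or_exists_eq_zerosOne x with rfl | ⟨n, y, rfl⟩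
    · exact glue_zeroSeq _ _
    · rw [zerosOne_mem_bourgainDeriv_glue,
        (hF n).eq_empty (s n.unpair.1).1.2 _ (by norm_num)] at hx
      exact absurd hx (Set.notMem_empty y)

theorem IsModel.bourgainRank_eq {b : Bool} {f : Cantor → ℝ} (h : IsModel ν b f) :
    bourgainRank f = ν + 1 :=
  bourgainRank_eq_add_one h.isBaireOne
    (fun p _ hε => h.eq_empty (Order.lt_add_one_iff.2 le_rfl) p hε) (by norm_num) h.nonempty

theorem IsModel.not_forcesNo {f : Cantor → ℝ} (h : IsModel ν false f) (hν : 1 ≤ ν) (p : ℚ)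
    (hε : 0 < ε) : ¬ ForcesNo f p ε ν := by
  rintro ⟨x, hx, hx'⟩
  have hεR : (0 : ℝ) < ε := by exact_mod_cast hε
  obtain ⟨h1, h2, -⟩ := h.of_mem hν hε hx
  rw [mem_hiSet, h.eq_cond x h1, cond_false] at hx'
  linarith

theorem IsModel.not_forcesYes {f : Cantor → ℝ} (h : IsModel ν true f) (hν : 1 ≤ ν) (p : ℚ)
    (hε : 0 < ε) : ¬ ForcesYes f p ε ν := by
  rintro ⟨x, hx, hx'⟩
  have hεR : (0 : ℝ) < ε := by exact_mod_cast hε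
  obtain ⟨h1, -, h2⟩ := h.of_mem hν hε hx
  rw [mem_loSet, h.eq_cond x h1, cond_true] at hx'
  linarith

theorem exists_leftSided (h1 : 1 ≤ ν) (hν : ν < ω₁) : ∃ f ∈ rankLevel (ν + 1), LeftSided f := by
  obtain ⟨f, hf⟩ := exists_isModel hν false
  exact ⟨f, ⟨hf.isBaireOne, hf.bourgainRank_eq⟩, (leftSided_iff hf.isBaireOne hf.bourgainRank_eq).2
    fun p ε hε => hf.not_forcesNo h1 p hε⟩

theorem exists_rightSided (h1 : 1 ≤ ν) (hν : ν < ω₁) : ∃ f ∈ rankLevel (ν + 1), RightSided f := by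
  obtain ⟨f, hf⟩ := exists_isModel hν true
  exact ⟨f, ⟨hf.isBaireOne, hf.bourgainRank_eq⟩, (rightSided_iff hf.isBaireOne hf.bourgainRank_eq).2
    fun p ε hε => hf.not_forcesYes h1 p hε⟩

/-- Two functions side by side: `l` on the sequences `1x`, `r` on the sequences `01x`, and `0`
elsewhere. -/
noncomputable def glueTwo (l r : Cantor → ℝ) : Cantor → ℝ :=
  glue 0 fun n => if n = 0 then l else if n = 1 then r else fun _ => 0

section glueTwo

variable {l r : Cantor → ℝ}

theorem IsBaireOne.glueTwo (hl : IsBaireOne l) (hr : IsBaireOne r) : IsBaireOne (glueTwo l r) := by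
  refine .glue (fun n => ?_) 0
  split_ifs
  exacts [hl, hr, continuous_const.isBaireOne]

/-- Past the first step, only the two given functions contribute. -/
theorem exists_of_mem_bourgainDeriv_glueTwo (hε : 0 < ε) (hν : 1 ≤ ν) {x : Cantor}
    (hx : x ∈ bourgainDeriv (glueTwo l r) p ε ν) :
    (∃ y ∈ bourgainDeriv l p ε ν, glueTwo l r x = l y) ∨
      ∃ y ∈ bourgainDeriv r p ε ν, glueTwo l r x = r y := by
  rcases eq_zeroSeq_or_exists_eq_zerosOne x with rfl | ⟨n, y, rfl⟩
  · refine absurd hx (notMem_bourgainDeriv_of_continuousAt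
      (continuousAt_glue_zeroSeq fun V hV => ⟨2, fun n hn x => ?_⟩) hε hν)
    rw [if_neg (by omega), if_neg (by omega)]
    exact mem_of_mem_nhds hV
  · rw [glueTwo, zerosOne_mem_bourgainDeriv_glue] at hx
    rw [glueTwo, glue_zerosOne]
    split_ifs at hx ⊢
    · exact Or.inl ⟨y, hx, rfl⟩
    · exact Or.inr ⟨y, hx, rfl⟩
    · exact absurd hx (notMem_bourgainDeriv_of_continuousAt continuousAt_const hε hν)

theorem exists_mem_bourgainDeriv_glueTwo_left {y : Cantor} (hy : y ∈ bourgainDeriv l p ε ν) :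
    ∃ x ∈ bourgainDeriv (glueTwo l r) p ε ν, glueTwo l r x = l y :=
  ⟨zerosOne 0 y, zerosOne_mem_bourgainDeriv_glue.2 hy, glue_zerosOne _ _ _ _⟩

theorem exists_mem_bourgainDeriv_glueTwo_right {y : Cantor} (hy : y ∈ bourgainDeriv r p ε ν) :
    ∃ x ∈ bourgainDeriv (glueTwo l r) p ε ν, glueTwo l r x = r y :=
  ⟨zerosOne 1 y, zerosOne_mem_bourgainDeriv_glue.2 hy, glue_zerosOne _ _ _ _⟩

theorem bourgainDeriv_glueTwo_eq_empty (hε : 0 < ε) (hν : 1 ≤ ν)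
    (hl : bourgainDeriv l p ε ν = ∅) (hr : bourgainDeriv r p ε ν = ∅) :
    bourgainDeriv (glueTwo l r) p ε ν = ∅ := by
  refine Set.eq_empty_of_forall_notMem fun x hx => ?_
  rcases exists_of_mem_bourgainDeriv_glueTwo hε hν hx with ⟨y, hy, -⟩ | ⟨y, hy, -⟩
  · rw [hl] at hy
    exact hy
  · rw [hr] at hy
    exact hy

end glueTwo

theorem exists_twoSided (h1 : 1 ≤ ν) (hν : ν < ω₁) : ∃ f ∈ rankLevel (ν + 1), TwoSided f := by
  obtain ⟨l, hl⟩ := exists_isModel hν false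
  obtain ⟨r, hr⟩ := exists_isModel hν true
  have hf := hl.isBaireOne.glueTwo hr.isBaireOne
  have hlt : ν < ν + 1 := Order.lt_add_one_iff.2 le_rfl
  obtain ⟨y, hy⟩ := hl.nonempty
  obtain ⟨z, hz⟩ := hr.nonempty
  obtain ⟨x, hx, hxy⟩ := exists_mem_bourgainDeriv_glueTwo_left (r := r) hy
  obtain ⟨w, hw, hwz⟩ := exists_mem_bourgainDeriv_glueTwo_right (l := l) hz
  have hrank : bourgainRank (glueTwo l r) = ν + 1 := bourgainRank_eq_add_one hf
    (fun p ε hε => bourgainDeriv_glueTwo_eq_empty hε (h1.trans hlt.le) (hl.eq_empty hlt p hε)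
      (hr.eq_empty hlt p hε)) (by norm_num) ⟨x, hx⟩
  refine ⟨_, ⟨hf, hrank⟩, (twoSided_iff hf hrank).2 ⟨1 / 2, 1 / 2, by norm_num, ⟨x, hx, ?_⟩,
    ⟨w, hw, ?_⟩⟩⟩
  · rw [mem_loSet, hxy, hl.eq_cond y hy]
    norm_num
  · rw [mem_hiSet, hwz, hr.eq_cond z hz]
    norm_num

/-- A left-sided and a right-sided function are placed side by side with disjoint ranges, so that
no single question sees both of them. -/
theorem exists_oneSided_not_leftSided_not_rightSided (h1 : 1 ≤ ν) (hν : ν < ω₁) :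
    ∃ f ∈ rankLevel (ν + 1), OneSided f ∧ ¬ LeftSided f ∧ ¬ RightSided f := by
  obtain ⟨l, hl⟩ := exists_isModel hν false
  obtain ⟨r, hr⟩ := exists_isModel hν true
  let r' : Cantor → ℝ := fun x => (1 : ℚ) * r x + (2 : ℚ)
  have hr' : ∀ (p ε : ℚ) (μ : Ordinal.{0}),
      bourgainDeriv r' p ε μ = bourgainDeriv r (p - 2) ε μ := fun p ε μ => by
    rw [bourgainDeriv_affine r p ε μ one_pos 2, div_one, div_one]
  have hf := hl.isBaireOne.glueTwo (hr.isBaireOne.affine 1 2)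
  have hlt : ν < ν + 1 := Order.lt_add_one_iff.2 le_rfl
  obtain ⟨y, hy⟩ := hl.nonempty
  obtain ⟨z, hz⟩ := hr.nonempty
  obtain ⟨x, hx, hxy⟩ := exists_mem_bourgainDeriv_glueTwo_left (r := r') hy
  obtain ⟨w, hw, hwz⟩ := exists_mem_bourgainDeriv_glueTwo_right (l := l) (r := r') (p := 5 / 2)
    (ε := 1 / 2) (ν := ν) (y := z) (by rw [hr']; norm_num at hz ⊢; exact hz)
  have hrank : bourgainRank (glueTwo l r') = ν + 1 := bourgainRank_eq_add_one hf
    (fun p ε hε => bourgainDeriv_glueTwo_eq_empty hε (h1.trans hlt.le) (hl.eq_empty hlt p hε)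
      (by rw [hr']; exact hr.eq_empty hlt _ hε)) (by norm_num) ⟨x, hx⟩
  refine ⟨_, ⟨hf, hrank⟩, (oneSided_iff hrank).2 ?_, ?_, ?_⟩
  · rw [twoSided_iff hf hrank]
    rintro ⟨p, ε, hε, ⟨x, hx, hxlo⟩, ⟨w, hw, hwhi⟩⟩
    have hεR : (0 : ℝ) < ε := by exact_mod_cast hε
    rw [mem_loSet] at hxlo
    rw [mem_hiSet] at hwhi
    rcases exists_of_mem_bourgainDeriv_glueTwo hε h1 hx with ⟨y, hy, hxy⟩ | ⟨y, hy, hxy⟩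
    · obtain ⟨-, hp, hp'⟩ := hl.of_mem h1 hε hy
      rcases exists_of_mem_bourgainDeriv_glueTwo hε h1 hw with ⟨z, hz, hwz⟩ | ⟨z, hz, hwz⟩
      · exact hl.not_forcesNo h1 p hε ⟨z, hz, by rwa [mem_hiSet, ← hwz]⟩
      · rw [hr'] at hz
        obtain ⟨-, hq, -⟩ := hr.of_mem h1 hε hz
        push_cast at hq
        linarith
    · rw [hr'] at hy
      refine hr.not_forcesYes h1 _ hε ⟨y, hy, ?_⟩
      rw [mem_loSet]
      rw [hxy] at hxlo
      push_cast at hxlo ⊢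
      linarith
  · rw [leftSided_iff hf hrank]
    intro h
    refine h (5 / 2) (1 / 2) (by norm_num) ⟨w, hw, ?_⟩
    rw [mem_hiSet, hwz]
    simp only [r']
    rw [hr.eq_cond z hz]
    norm_num
  · rw [rightSided_iff hf hrank]
    intro h
    refine h (1 / 2) (1 / 2) (by norm_num) ⟨x, hx, ?_⟩
    rw [mem_loSet, hxy, hl.eq_cond y hy]
    norm_num

/-- Models of all ranks below `ν` are glued with amplitudes tending to `0`: the gluing point is
a point of continuity, and no question lasts as long as `ν`. -/
theorem exists_mem_rankLevel_of_isSuccLimit (hl : Order.IsSuccLimit ν) (hν : ν < ω₁) :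
    ∃ f, f ∈ rankLevel ν := by
  have := countable_Iio_of_lt_omega_one hν
  have hν0 : 0 < ν := pos_iff_ne_zero.2 (Ordinal.isSuccLimit_iff.1 hl).1
  have : Nonempty (Set.Iio ν) := ⟨⟨0, hν0⟩⟩
  obtain ⟨s, hs⟩ := exists_surjective_nat (Set.Iio ν)
  choose m hm using fun j : Set.Iio ν => exists_isModel (j.2.trans hν) false
  let a : ℕ → ℚ := fun n => 1 / ((n : ℚ) + 1)
  have ha : ∀ n, 0 < a n := fun n => by positivity
  let F : ℕ → Cantor → ℝ := fun n x => a n * m (s n) x + (0 : ℚ)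
  have hFb : IsBaireOne (glue 0 F) := .glue (fun n => (hm (s n)).isBaireOne.affine _ _) 0
  have hF0 : ∀ V ∈ 𝓝 (0 : ℝ), ∃ N, ∀ n ≥ N, ∀ x, F n x ∈ V := by
    intro V hV
    obtain ⟨η, hη, hball⟩ := Metric.mem_nhds_iff.1 hV
    obtain ⟨N, hN⟩ := exists_nat_one_div_lt hη
    refine ⟨N, fun n hn x => hball ?_⟩
    have hle : 1 / ((n : ℝ) + 1) ≤ 1 / ((N : ℝ) + 1) := Nat.one_div_le_one_div hn
    have hpos : (0 : ℝ) < 1 / ((n : ℝ) + 1) := by positivity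
    rw [Metric.mem_ball, Real.dist_eq]
    simp only [F, a]
    push_cast
    rcases (hm (s n)).zero_or_one x with h | h
    · rw [h]
      simpa using hη
    · rw [h, mul_one, add_zero, sub_zero, abs_of_pos hpos]
      linarith
  refine ⟨glue 0 F, hFb, le_antisymm (bourgainRank_le fun p ε hε => ?_)
    (le_of_forall_lt fun μ hμ => ?_)⟩
  · refine bourgainDeriv_glue_eq_empty hF0 hε (Order.one_le_iff_pos.2 hν0) fun n => ?_
    rw [bourgainDeriv_affine _ _ _ _ (ha n)]
    exact (hm (s n)).eq_empty (s n).2 _ (div_pos hε (ha n))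
  · obtain ⟨n, hn⟩ := hs ⟨μ, hμ⟩
    obtain ⟨y, hy⟩ := (hm (s n)).nonempty
    refine lt_bourgainRank_iff.2 ⟨a n * (1 / 2), a n * (1 / 2), by have := ha n; positivity,
      lt_alphaAt hFb (by have := ha n; positivity) ⟨zerosOne n y, ?_⟩⟩
    rw [zerosOne_mem_bourgainDeriv_glue, bourgainDeriv_affine _ _ _ _ (ha n), sub_zero,
      mul_div_cancel_left₀ _ (ha n).ne']
    rw [hn] at hy ⊢
    exact hy

end models

/-! ### The degrees within a rank level -/

theorem mem_mDegree_self (f : Cantor → ℝ) : f ∈ mDegree f := ⟨.refl f, .refl f⟩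

theorem mDegree_eq_of_mem {f h : Cantor → ℝ} (hh : h ∈ mDegree f) : mDegree h = mDegree f := by
  ext k
  exact ⟨fun hk => ⟨hk.1.trans hh.1, hh.2.trans hk.2⟩, fun hk => ⟨hk.1.trans hh.2, hh.1.trans hk.2⟩⟩

theorem mDegree_ne_of_not_mReducible {f g : Cantor → ℝ} (h : ¬ MReducible f g) :
    mDegree f ≠ mDegree g := fun heq => by
  have := mem_mDegree_self f
  rw [heq] at this
  exact h this.1

theorem mDegree_subset_rankLevel {f : Cantor → ℝ} {ν : Ordinal.{0}} (hf : f ∈ rankLevel ν) :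
    mDegree f ⊆ rankLevel ν := fun h hh => by
  have hb : IsBaireOne h := hf.1.of_mReducible hh.1
  exact ⟨hb, ((bourgainRank_le_of_mReducible hf.1 hh.1).antisymm
    (bourgainRank_le_of_mReducible hb hh.2)).trans hf.2⟩

theorem rankLevel_eq_mDegree {f : Cantor → ℝ} {ν : Ordinal.{0}} (hν : Order.IsSuccLimit ν)
    (hf : f ∈ rankLevel ν) : rankLevel ν = mDegree f := by
  refine Set.Subset.antisymm (fun h hh => ?_) (mDegree_subset_rankLevel hf)
  have heq : bourgainRank h = bourgainRank f := hh.2.trans hf.2.symm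
  exact ⟨mReducible_of_isSuccLimit hh.1 heq (by rwa [hh.2]),
    mReducible_of_isSuccLimit hf.1 heq.symm (by rwa [hf.2])⟩

section successor

variable {f g h : Cantor → ℝ} {ν : Ordinal.{0}}

theorem mReducible_iff_of_mem_rankLevel (hf : f ∈ rankLevel (ν + 1)) (hg : g ∈ rankLevel (ν + 1)) :
    MReducible f g ↔ TwoSided g ∨ (¬ TwoSided f ∧ ¬ RightSided g ∧ ¬ LeftSided g) ∨
      ((RightSided f ∧ RightSided g) ∨ (LeftSided f ∧ LeftSided g)) := by
  rw [mReducible_iff_of_add_one hf.1 hg.1 hf.2 hg.2, oneSided_iff hf.2]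

theorem mem_mDegree_iff (hf : f ∈ rankLevel (ν + 1)) :
    h ∈ mDegree f ↔ h ∈ rankLevel (ν + 1) ∧ (TwoSided h ↔ TwoSided f) ∧
      (LeftSided h ↔ LeftSided f) ∧ (RightSided h ↔ RightSided f) := by
  have key : ∀ hh : h ∈ rankLevel (ν + 1), (MReducible h f ∧ MReducible f h ↔
      (TwoSided h ↔ TwoSided f) ∧ (LeftSided h ↔ LeftSided f) ∧
        (RightSided h ↔ RightSided f)) := fun hh => by
    rw [mReducible_iff_of_mem_rankLevel hf hh, mReducible_iff_of_mem_rankLevel hh hf]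
    have h1 := LeftSided.not_twoSided hf.1
    have h2 := RightSided.not_twoSided hf.1
    have h3 := LeftSided.not_twoSided hh.1
    have h4 := RightSided.not_twoSided hh.1
    have h5 := not_leftSided_and_rightSided hf.1 hf.2
    have h6 := not_leftSided_and_rightSided hh.1 hh.2
    grind
  exact ⟨fun hm => have hh := mDegree_subset_rankLevel hf hm
    ⟨hh, (key hh).1 hm⟩, fun hm => (key hm.1).2 hm.2⟩

theorem mDegree_eq_twoSided (hf : f ∈ rankLevel (ν + 1)) (ht : TwoSided f) :
    mDegree f = {h ∈ rankLevel (ν + 1) | TwoSided h} := by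
  ext h
  rw [mem_mDegree_iff hf]
  rw [Set.mem_ofPred_eq]
  refine and_congr_right fun hh => ?_
  have h1 := LeftSided.not_twoSided hf.1
  have h2 := RightSided.not_twoSided hf.1
  have h3 := LeftSided.not_twoSided hh.1
  have h4 := RightSided.not_twoSided hh.1
  grind

theorem mDegree_eq_oneSided (hf : f ∈ rankLevel (ν + 1))
    (ho : OneSided f ∧ ¬ LeftSided f ∧ ¬ RightSided f) :
    mDegree f = {h ∈ rankLevel (ν + 1) | OneSided h ∧ ¬ LeftSided h ∧ ¬ RightSided h} := by
  rw [oneSided_iff hf.2] at ho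
  ext h
  rw [mem_mDegree_iff hf]
  rw [Set.mem_ofPred_eq]
  refine and_congr_right fun hh => ?_
  rw [oneSided_iff hh.2]
  grind

theorem mDegree_eq_leftSided (hf : f ∈ rankLevel (ν + 1)) (hl : LeftSided f) :
    mDegree f = {h ∈ rankLevel (ν + 1) | LeftSided h} := by
  ext h
  rw [mem_mDegree_iff hf]
  rw [Set.mem_ofPred_eq]
  refine and_congr_right fun hh => ?_
  have h1 := LeftSided.not_twoSided hf.1
  have h3 := LeftSided.not_twoSided hh.1
  have h5 := not_leftSided_and_rightSided hf.1 hf.2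
  have h6 := not_leftSided_and_rightSided hh.1 hh.2
  grind

theorem mDegree_eq_rightSided (hf : f ∈ rankLevel (ν + 1)) (hr : RightSided f) :
    mDegree f = {h ∈ rankLevel (ν + 1) | RightSided h} := by
  ext h
  rw [mem_mDegree_iff hf]
  rw [Set.mem_ofPred_eq]
  refine and_congr_right fun hh => ?_
  have h2 := RightSided.not_twoSided hf.1
  have h4 := RightSided.not_twoSided hh.1
  have h5 := not_leftSided_and_rightSided hf.1 hf.2
  have h6 := not_leftSided_and_rightSided hh.1 hh.2
  grind

end successor

theorem mainTheorem1 :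
    (∀ f g : Cantor → ℝ, IsBaireOne f → IsBaireOne g →
      bourgainRank f < bourgainRank g → MReducible f g) ∧
    (∀ f g : Cantor → ℝ, IsBaireOne f → IsBaireOne g → bourgainRank f = bourgainRank g →
      (MReducible f g ↔
        Order.IsSuccLimit (bourgainRank f) ∨
        TwoSided g ∨
        (OneSided f ∧ ¬ RightSided g ∧ ¬ LeftSided g) ∨
        ((RightSided f ∧ RightSided g) ∨ (LeftSided f ∧ LeftSided g)))) ∧
    -- every countable limit level is one degree
    (∀ ν : Ordinal.{0}, Order.IsSuccLimit ν → ν < ω₁ →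
      ∃ f ∈ rankLevel ν, rankLevel ν = mDegree f) ∧
    -- every countable successor level above the continuous functions consists of four degrees
    (∀ ν : Ordinal.{0}, 1 ≤ ν → ν < ω₁ →
      ∃ t o l r : Cantor → ℝ,
        mDegree t = {f ∈ rankLevel (ν + 1) | TwoSided f} ∧
        mDegree o = {f ∈ rankLevel (ν + 1) | OneSided f ∧ ¬ LeftSided f ∧ ¬ RightSided f} ∧
        mDegree l = {f ∈ rankLevel (ν + 1) | LeftSided f} ∧
        mDegree r = {f ∈ rankLevel (ν + 1) | RightSided f} ∧
        mDegree '' rankLevel (ν + 1) = {mDegree t, mDegree o, mDegree l, mDegree r} ∧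
        (mDegree '' rankLevel (ν + 1)).ncard = 4 ∧
        rankLevel (ν + 1) = mDegree t ∪ mDegree o ∪ mDegree l ∪ mDegree r ∧
        -- the order between the four degrees
        MReducible o t ∧ MReducible l o ∧ MReducible r o ∧
        ¬ MReducible t o ∧ ¬ MReducible o l ∧ ¬ MReducible o r ∧
        ¬ MReducible l r ∧ ¬ MReducible r l) := by
  refine ⟨fun f g hf _ => mReducible_of_bourgainRank_lt hf,
    fun f g hf hg => mReducible_iff_of_bourgainRank_eq hf hg, fun ν hl hν => ?_, fun ν h1 hν => ?_⟩
  · obtain ⟨f, hf⟩ := exists_mem_rankLevel_of_isSuccLimit hl hν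
    exact ⟨f, hf, rankLevel_eq_mDegree hl hf⟩
  obtain ⟨t, ht, ht'⟩ := exists_twoSided h1 hν
  obtain ⟨o, ho, ho'⟩ := exists_oneSided_not_leftSided_not_rightSided h1 hν
  obtain ⟨l, hl, hl'⟩ := exists_leftSided h1 hν
  obtain ⟨r, hr, hr'⟩ := exists_rightSided h1 hν
  have hT := mDegree_eq_twoSided ht ht'
  have hO := mDegree_eq_oneSided ho ho'
  have hL := mDegree_eq_leftSided hl hl'
  have hR := mDegree_eq_rightSided hr hr'
  have hcover : rankLevel (ν + 1) = mDegree t ∪ mDegree o ∪ mDegree l ∪ mDegree r := by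
    rw [hT, hO, hL, hR]
    ext f
    simp only [Set.mem_union, Set.mem_ofPred_eq]
    constructor
    · intro hf
      rw [oneSided_iff hf.2]
      grind
    · rintro (((hf | hf) | hf) | hf) <;> exact hf.1
  have ho2 := (oneSided_iff ho.2).1 ho'.1
  have hl2 := hl'.not_twoSided hl.1
  have hr2 := hr'.not_twoSided hr.1
  have hlr : ¬ RightSided l := fun h => not_leftSided_and_rightSided hl.1 hl.2 ⟨hl', h⟩
  have hrl : ¬ LeftSided r := fun h => not_leftSided_and_rightSided hr.1 hr.2 ⟨h, hr'⟩
  have hot : MReducible o t := (mReducible_iff_of_mem_rankLevel ho ht).2 (by grind)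
  have hlo : MReducible l o := (mReducible_iff_of_mem_rankLevel hl ho).2 (by grind)
  have hro : MReducible r o := (mReducible_iff_of_mem_rankLevel hr ho).2 (by grind)
  have nto : ¬ MReducible t o := by rw [mReducible_iff_of_mem_rankLevel ht ho]; grind
  have nol : ¬ MReducible o l := by rw [mReducible_iff_of_mem_rankLevel ho hl]; grind
  have nor : ¬ MReducible o r := by rw [mReducible_iff_of_mem_rankLevel ho hr]; grind
  have nlr : ¬ MReducible l r := by rw [mReducible_iff_of_mem_rankLevel hl hr]; grind
  have nrl : ¬ MReducible r l := by rw [mReducible_iff_of_mem_rankLevel hr hl]; grind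
  have himage : mDegree '' rankLevel (ν + 1) = {mDegree t, mDegree o, mDegree l, mDegree r} := by
    refine Set.Subset.antisymm ?_ ?_
    · rintro _ ⟨f, hf, rfl⟩
      rw [hcover] at hf
      simp only [Set.mem_insert_iff, Set.mem_singleton_iff]
      rcases hf with ((hf | hf) | hf) | hf <;> simp [mDegree_eq_of_mem hf]
    · rintro _ (rfl | rfl | rfl | rfl)
      exacts [⟨t, ht, rfl⟩, ⟨o, ho, rfl⟩, ⟨l, hl, rfl⟩, ⟨r, hr, rfl⟩]
  refine ⟨t, o, l, r, hT, hO, hL, hR, himage, ?_, hcover, hot, hlo, hro, nto, nol, nor, nlr, nrl⟩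
  have nto' := mDegree_ne_of_not_mReducible nto
  have ntl' := mDegree_ne_of_not_mReducible fun h => nto (h.trans hlo)
  have ntr' := mDegree_ne_of_not_mReducible fun h => nto (h.trans hro)
  have nol' := mDegree_ne_of_not_mReducible nol
  have nor' := mDegree_ne_of_not_mReducible nor
  have nlr' := mDegree_ne_of_not_mReducible nlr
  rw [himage, Set.ncard_insert_of_notMem, Set.ncard_insert_of_notMem, Set.ncard_pair nlr']
  · rintro (h | h)
    exacts [nol' h, nor' h]
  · rintro (h | h | h)
    exacts [nto' h, ntl' h, ntr' h]
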